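/- **Setting.** Let $K\ge 1$ and $1\le r\le p\le d$ be integers. For a tensor $\mathcal T\in\mathbb R^{n\times\cdots\times n}$ of order $K$ and matrices $A_k\in\mathbb R^{m\times n}$, let $\mathcal T\times\{A_1,\dots,A_K\}\in\mathbb R^{m\times\cdots\times m}$ be the tensor with entries $\sum_{j_1,\dots,j_K}\mathcal T_{j_1\dots j_K}\prod_k (A_k)_{i_kj_k}$. Let $\nu$ be a measure on $\mathbb R$, $\phi>0$ and $b:\mathbb R\to\mathbb R$ such that for every $\theta\in\mathbb R$ the density $\exp\{(y\theta-b(\theta))/\phi\}$ with respect to $\nu$ defines a probability measure $Q_\theta$ (the factor $c(y,\phi)$ of the exponential family is part of $\nu$). *Model.* There are feature matrices $Z_1,\dots,Z_K\in\mathbb R^{d\times p}$ (fixed or random) and a response tensor $\mathcal Y\in\mathbb R^{d\times\cdots\times d}$ of order $K$. Conditionally on the features, the entries of $\mathcal Y$ are independent and the entry with index $i$ has law $Q_{\theta_i}$, where $\Theta_{\rm true}=(\theta_i)=\mathcal B_{\rm true}\times\{Z_1,\dots,Z_K\}$ and $\mathcal B_{\rm true}=\mathcal C_{\rm true}\times\{M_{1,\rm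 true},\dots,M_{K,\rm true}\}$ with $\mathcal C_{\rm true}\in\mathbb R^{r\times\cdots\times r}$ and $M_{k,\rm true}\in\mathbb R^{p\times r}$. *Estimator.* Let $\alpha\in(0,\infty]$. The parameter space $\mathcal P$ is the set of all $(\mathcal C,M_1,\dots,M_K)$, with $\mathcal C\in\mathbb R^{r\times\cdots\times r}$ and $M_k\in\mathbb R^{p\times r}$, such that $M_k^TM_k=I$ for all $k$ and all entries of $\Theta=\mathcal C\times\{Z_1M_1,\dots,Z_KM_K\}$ are at most $\alpha$ in absolute value. An MLE $(\hat{\mathcal C},\hat M_1,\dots,\hat M_K)$ is any maximizer over $\mathcal P$ of $\langle\mathcal Y,\Theta\rangle-\sum_i b(\theta_i)$, and $\hat{\mathcal B}_{\rm MLE}=\hat{\mathcal C}\times\{\hat M_1,\dots,\hat M_K\}$, $\hat M_{k,\rm MLE}=\hat M_k$. *Error measures.* For $A,B\in\mathbb R^{p\times r}$ with orthonormal columns, $\sin\Theta(A,B)$ is the maximum of $\langle x,y\rangle/(\|x\|\|y\|)$ over nonzero $x$ in the column space of $A$ and nonzero $y$ orthogonal to the column space of $B$ (zero if there are none). Let $\lambda=\min_k\sigma_r(\mathrm{Unfold}_k(\mathcal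 B_{\rm true}))$, where $\mathrm{Unfold}_k$ is the mode-$k$ unfolding and $\sigma_r$ is the $r$-th largest singular value. *Assumptions*, with constants $0<c_1,c_2$, $0<L,U$ and $0<\rho<1$: * **A1.** $c_1\le\sigma_{\min}(X_k)\le\sigma_{\max}(X_k)\le c_2$ for all $k$, and the features in the model and in the MLE are $Z_k=\sqrt d\,X_k$. * **A1′.** Each $X_k$ has i.i.d. $N(0,1)$ entries, the features in the model and in the MLE are $Z_k=X_k$, and $p\le\rho d$. * **A2.** $b''(\theta)\ge L$ whenever $|\theta|\le\alpha$, and $b''(\theta)\le U$ for all $\theta\in\mathbb R$; equivalently, the variance $\phi b''(\theta)$ of $Q_\theta$ is at least $\phi L$ for $|\theta|\le\alpha$ and at most $\phi U$ everywhere. **Theorem 1 (Statistical rate for global optimizers).** Assume A2 together with either A1 or A1′. Then there is a constant $C>0$, depending only on $K,L,U,c_1,c_2$ under A1 and only on $K,L,U,\rho$ under A1′, such that with probability at least $1-\exp(-p)$ the following holds: if the true parameter $(\mathcal C_{\rm true},M_{1,\rm true},\dots,M_{K,\rm true})$ belongs to $\mathcal P$, then every MLE satisfies $$\|\mathcal B_{\rm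 true}-\hat{\mathcal B}_{\rm MLE}\|_F^2\le C\,\frac{\phi\,(r^K+Kpr)}{d^K}$$ and, provided that $\lambda>0$, $$\max_{1\le k\le K}\sin^2\Theta\big(M_{k,\rm true},\hat M_{k,\rm MLE}\big)\le C\,\frac{\phi\,(r^K+Kpr)}{\lambda^2 d^K}.$$ (Under A1 with fixed features, membership of the true parameter in $\mathcal P$ is a deterministic condition. For $\alpha=\infty$ it only says that the $M_{k,\rm true}$ have orthonormal columns.) -/

import Mathlib

open MeasureTheory ProbabilityTheory
open scoped ENNReal

noncomputable section

namespace TensorGLM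

/-- Real tensors of order `K` with all `K` dimensions equal to `n`. -/
abbrev Tensor (K n : ℕ) : Type := (Fin K → Fin n) → ℝ

/-- The multilinear product `T × {A₁, …, A_K}`. -/
def multiProd {K n m : ℕ} (T : Tensor K n) (A : Fin K → Matrix (Fin m) (Fin n) ℝ) :
    Tensor K m :=
  fun i => ∑ j : Fin K → Fin n, T j * ∏ k, A k (i k) (j k)

/-- The squared Frobenius norm. -/
def frobSq {K n : ℕ} (T : Tensor K n) : ℝ := ∑ i, T i ^ 2

/-- The mode-`k` unfolding: rows are indexed by the `k`-th index, columns by all the others. -/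
def unfold {K n : ℕ} (k : Fin K) (T : Tensor K n) :
    Matrix (Fin n) ({l : Fin K // l ≠ k} → Fin n) ℝ :=
  Matrix.of fun a s => T ((Equiv.funSplitAt k (Fin n)).symm (a, s))

/-- The `i`-th largest singular value of a matrix, for `i = 1, 2, …` (zero for `i` larger than
the number of columns). -/
def singVal {m n : Type} [Fintype m] [Fintype n] [DecidableEq n]
    (A : Matrix m n ℝ) (i : ℕ) : ℝ :=
  (Matrix.toEuclideanLin A).singularValues (i - 1)

/-- The column space of a matrix. -/
def colSpan {n r : ℕ} (A : Matrix (Fin n) (Fin r) ℝ) : Submodule ℝ (EuclideanSpace ℝ (Fin n)) :=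
  LinearMap.range (Matrix.toEuclideanLin A)

/-- The angle distance: the largest cosine between a vector of the column space of `A` and a
vector orthogonal to the column space of `B` (it is `0` if there are no such nonzero vectors). -/
def sinTheta {n r : ℕ} (A B : Matrix (Fin n) (Fin r) ℝ) : ℝ :=
  sSup {t : ℝ | ∃ x ∈ colSpan A, ∃ y ∈ (colSpan B)ᗮ, x ≠ 0 ∧ y ≠ 0 ∧
    t = inner ℝ x y / (‖x‖ * ‖y‖)}

/-- A core tensor together with one factor matrix for each mode. -/
structure Params (K p r : ℕ) where
  core : Tensor K r
  factor : Fin K → Matrix (Fin p) (Fin r) ℝ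

/-- The coefficient tensor `B = C × {M₁, …, M_K}`. -/
def Params.coef {K p r : ℕ} (w : Params K p r) : Tensor K p := multiProd w.core w.factor

/-- The signal level: the minimum over the modes of the `r`-th singular value of the unfolding. -/
def Params.signal {K p r : ℕ} (w : Params K p r) : ℝ := ⨅ k : Fin K, singVal (unfold k w.coef) r

/-- The parameter space: factors with orthonormal columns, and a linear predictor
`B × {Z₁, …, Z_K}` with entries bounded by `α` in absolute value (no bound if `α = ∞`). -/
def Feasible {K d p r : ℕ} (α : ℝ≥0∞) (Z : Fin K → Matrix (Fin d) (Fin p) ℝ)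
    (w : Params K p r) : Prop :=
  (∀ k, (w.factor k).transpose * w.factor k = 1) ∧
    ∀ i, ENNReal.ofReal |multiProd w.coef Z i| ≤ α

/-- The quasi log-likelihood `⟨Y, Θ⟩ - ∑ b(θ)` at `Θ = B × {Z₁, …, Z_K}`. -/
def logLik {K d p r : ℕ} (b : ℝ → ℝ) (Z : Fin K → Matrix (Fin d) (Fin p) ℝ) (y : Tensor K d)
    (w : Params K p r) : ℝ :=
  ∑ i, y i * multiProd w.coef Z i - ∑ i, b (multiProd w.coef Z i)

/-- `w` is a rank-constrained maximum likelihood estimate for the data `y` and features `Z`. -/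
def IsMLE {K d p r : ℕ} (b : ℝ → ℝ) (α : ℝ≥0∞) (Z : Fin K → Matrix (Fin d) (Fin p) ℝ)
    (y : Tensor K d) (w : Params K p r) : Prop :=
  Feasible α Z w ∧ ∀ w' : Params K p r, Feasible α Z w' → logLik b Z y w' ≤ logLik b Z y w

/-- The exponential family member with natural parameter `θ`: it has density
`exp ((y θ - b θ) / φ)` with respect to the base measure `ν`. The base measure carries the factor
`c(y, φ)` and the reference (Lebesgue, counting, …) measure on the observation domain. -/
def expFamLaw (ν : Measure ℝ) (b : ℝ → ℝ) (φ θ : ℝ) : Measure ℝ :=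
  ν.withDensity fun y => ENNReal.ofReal (Real.exp ((y * θ - b θ) / φ))

/-- `ν`, `b`, `φ` define an exponential family with natural parameter ranging over the real line
and dispersion `φ > 0`. -/
def IsExpFamily (ν : Measure ℝ) (b : ℝ → ℝ) (φ : ℝ) : Prop :=
  0 < φ ∧ ∀ θ : ℝ, IsProbabilityMeasure (expFamLaw ν b φ θ)

/-- The curvature condition: `b'' ≥ L` on `|θ| ≤ α` and `b'' ≤ U` everywhere. As the variance of
`expFamLaw ν b φ θ` is `φ * b''(θ)`, this says that the variance is at least `φ L` for
`|θ| ≤ α` and at most `φ U` for all `θ`. -/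
def CurvatureBounds (b : ℝ → ℝ) (α : ℝ≥0∞) (L U : ℝ) : Prop :=
  (∀ θ : ℝ, ENNReal.ofReal |θ| ≤ α → L ≤ deriv (deriv b) θ) ∧ ∀ θ : ℝ, deriv (deriv b) θ ≤ U

/-- The generalized tensor model: conditionally on the (possibly random) features `Z`, the entries
of `Y` are independent and the entry `Y i` follows the exponential family at the `i`-th entry
of the linear predictor `B × {Z₁, …, Z_K}`. In other words, the product of these laws is the
conditional distribution of `Y` given `Z`. -/
def TensorModel {K d p : ℕ} (ν : Measure ℝ) (b : ℝ → ℝ) (φ : ℝ) (B : Tensor K p)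
    {Ω : Type*} [MeasurableSpace Ω] (P : Measure Ω)
    (Z : Ω → Fin K → Matrix (Fin d) (Fin p) ℝ) (Y : Ω → Tensor K d) : Prop :=
  (∀ k i j, Measurable fun ω => Z ω k i j) ∧ Measurable Y ∧
    ∀ (A : Set (Fin K → Fin d → Fin p → ℝ)) (S : Set (Tensor K d)),
      MeasurableSet A → MeasurableSet S →
        P {ω | (fun k i j => Z ω k i j) ∈ A ∧ Y ω ∈ S} =
          ∫⁻ ω in {ω | (fun k i j => Z ω k i j) ∈ A},
            Measure.pi (fun i => expFamLaw ν b φ (multiProd B (Z ω) i)) S ∂P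

/-- Almost surely (surely, for fixed features) all features have all their singular values
between `c₁` and `c₂`. -/
def BoundedDesign {K d p : ℕ} (c₁ c₂ : ℝ) {Ω : Type*} [MeasurableSpace Ω] (P : Measure Ω)
    (X : Ω → Fin K → Matrix (Fin d) (Fin p) ℝ) : Prop :=
  ∀ᵐ ω ∂P, ∀ k, c₁ ≤ singVal (X ω k) p ∧ singVal (X ω k) 1 ≤ c₂

/-- Each feature matrix has independent standard normal entries. -/
def GaussianDesign {K d p : ℕ} {Ω : Type*} [MeasurableSpace Ω] (P : Measure Ω)
    (X : Ω → Fin K → Matrix (Fin d) (Fin p) ℝ) : Prop :=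
  ∀ k, (∀ i j, HasLaw (fun ω => X ω k i j) (gaussianReal 0 1) P) ∧
    iIndepFun (fun (e : Fin d × Fin p) ω => X ω k e.1 e.2) P

/-- The two error bounds for an estimate `w` of the true parameter `w₀`, with constant `C`; the
one for the factors is asserted when the signal level is nonzero. -/
def ErrorBounds {K p r : ℕ} (d : ℕ) (φ C : ℝ) (w₀ w : Params K p r) : Prop :=
  frobSq (w₀.coef - w.coef) ≤ C * (φ * ((r : ℝ) ^ K + K * p * r) / (d : ℝ) ^ K) ∧
    (0 < w₀.signal → ∀ k, sinTheta (w₀.factor k) (w.factor k) ^ 2 ≤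
      C * (φ * ((r : ℝ) ^ K + K * p * r) / (w₀.signal ^ 2 * (d : ℝ) ^ K)))

end TensorGLM

end

noncomputable section

/-! Write `Δ` for the estimate minus the true coefficient tensor and `E` for the residual `Y -
b'(Θ)` at the truth. Optimality of the likelihood and the curvature of `b` on `|θ| ≤ α` give `L/2 ‖Δ
× Z‖² ≤ ⟨E, Δ × Z⟩` (`IsMLE.frobSq_predictor_le`), while the design gives `‖Δ × Z‖² ≥ a₁^K ‖Δ‖²`. It
remains to bound the inner product by `τ ‖Δ‖` uniformly over all possible `Δ`.

Since `Δ` is a difference of two rank-`r` Tucker tensors, it equals `G × N` with contractions `N k`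
having `2r` columns and `‖G‖ ≤ ‖Δ‖` (`exists_tucker_sub`). Nets for cores and factors reduce the
supremum to at most `5^((2r)^K + 2Kpr)` fixed directions (`exists_tucker_net`). In each of them the
residual is sub-Gaussian with proxy `Uφ` per entry, because its log-mgf is a Taylor remainder of `b`
(`IsExpFamily.hasSubgaussianMGF`). A union bound gives `τ²` of order `φ a₂^K (r^K + Kpr)`; dividing
by `a₁^(2K)`, with `a₁` and `a₂` proportional to `d`, leaves the rate. The net does not depend on
the features, so the tail bound holds conditionally on `Z` and is then integrated
(`TensorModel.measure_le`).

For the factors, a vector of the true column space is the true unfolding applied to a vector shorter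
by the factor `λ`. A vector orthogonal to the estimated column space only sees the unfolding of `Δ`,
so every cosine is at most `‖Δ‖_F / λ` (`sinTheta_sq_mul_signal_sq_le`).

Gaussian features reduce to the same argument: chi-square tails and sphere nets bound all singular
values, the lower bound using that `p/d ≤ ρ < 1` lets the small-ball probability beat the size of
the net (`GaussianDesign.exists_designBounds`). -/

namespace TensorGLM

/-! ### Multilinear products and the Frobenius norm -/

lemma multiProd_sub {K n m : ℕ} (T S : Tensor K n) (A : Fin K → Matrix (Fin m) (Fin n) ℝ) :
    multiProd (T - S) A = multiProd T A - multiProd S A := by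
  funext i
  simp [multiProd, sub_mul, Finset.sum_sub_distrib]

lemma multiProd_multiProd {K n m l : ℕ} (T : Tensor K n) (A : Fin K → Matrix (Fin m) (Fin n) ℝ)
    (B : Fin K → Matrix (Fin l) (Fin m) ℝ) :
    multiProd (multiProd T A) B = multiProd T (fun k => B k * A k) := by
  funext i
  simp only [multiProd, Matrix.mul_apply, Finset.prod_univ_sum, Fintype.piFinset_univ,
    Finset.sum_mul, Finset.mul_sum]
  rw [Finset.sum_comm]
  refine Finset.sum_congr rfl fun a _ => Finset.sum_congr rfl fun b _ => ?_
  rw [Finset.prod_mul_distrib]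
  ring

lemma frobSq_nonneg {K n : ℕ} (T : Tensor K n) : 0 ≤ frobSq T :=
  Finset.sum_nonneg fun _ _ => sq_nonneg _

lemma frobSq_succ {K n : ℕ} (T : Tensor (K + 1) n) :
    frobSq T = ∑ a, frobSq fun i => T (Fin.cons a i) := by
  simp only [frobSq]
  rw [← Fintype.sum_prod_type' (f := fun a (i : Fin K → Fin n) => T (Fin.cons a i) ^ 2)]
  exact (Fintype.sum_equiv (Fin.consEquiv fun _ : Fin (K + 1) => Fin n) _ _ fun _ => rfl).symm

lemma multiProd_cons {K n m : ℕ} (T : Tensor (K + 1) n)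
    (A : Fin (K + 1) → Matrix (Fin m) (Fin n) ℝ) (a : Fin m) (i : Fin K → Fin m) :
    multiProd T A (Fin.cons a i) =
      (A 0).mulVec (fun b => multiProd (fun j => T (Fin.cons b j)) (fun k => A k.succ) i) a := by
  simp only [multiProd, Matrix.mulVec, dotProduct, Finset.mul_sum]
  rw [← Fintype.sum_prod_type' (f := fun b (j : Fin K → Fin n) =>
    A 0 a b * (T (Fin.cons b j) * ∏ k, A k.succ (i k) (j k)))]
  refine (Fintype.sum_equiv (Fin.consEquiv fun _ : Fin (K + 1) => Fin n) _ _ fun x => ?_).symm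
  simp only [Fin.consEquiv, Equiv.coe_fn_mk, Fin.prod_univ_succ, Fin.cons_zero, Fin.cons_succ]
  ring

lemma frobSq_multiProd_succ {K n m : ℕ} (T : Tensor (K + 1) n)
    (A : Fin (K + 1) → Matrix (Fin m) (Fin n) ℝ) :
    frobSq (multiProd T A) = ∑ i, ∑ a,
      (A 0).mulVec (fun b => multiProd (fun j => T (Fin.cons b j)) (fun k => A k.succ) i) a ^ 2 := by
  rw [frobSq_succ, Finset.sum_comm]
  simp only [frobSq, multiProd_cons]

/-- Peel off one mode at a time: with the remaining indices fixed, the first matrix acts on a vector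
and costs one factor `c`. -/
lemma frobSq_multiProd_le {K n m : ℕ} (T : Tensor K n) (A : Fin K → Matrix (Fin m) (Fin n) ℝ)
    {c : ℝ} (hc : 0 ≤ c) (hA : ∀ k x, ∑ i, (A k).mulVec x i ^ 2 ≤ c * ∑ j, x j ^ 2) :
    frobSq (multiProd T A) ≤ c ^ K * frobSq T := by
  induction K with
  | zero => simp [frobSq, multiProd]
  | succ K ih =>
    rw [frobSq_multiProd_succ, frobSq_succ T]
    calc _ ≤ ∑ i, c * ∑ b, multiProd (fun j => T (Fin.cons b j)) (fun k => A k.succ) i ^ 2 :=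
          Finset.sum_le_sum fun i _ => hA 0 _
      _ = c * ∑ b, frobSq (multiProd (fun j => T (Fin.cons b j)) (fun k => A k.succ)) := by
          rw [← Finset.mul_sum, Finset.sum_comm]; rfl
      _ ≤ c * ∑ b, c ^ K * frobSq (fun j => T (Fin.cons b j)) := by
          gcongr with b
          exact ih _ _ fun k x => hA k.succ x
      _ = _ := by rw [← Finset.mul_sum, pow_succ]; ring

lemma le_frobSq_multiProd {K n m : ℕ} (T : Tensor K n) (A : Fin K → Matrix (Fin m) (Fin n) ℝ)
    {c : ℝ} (hc : 0 ≤ c) (hA : ∀ k x, c * ∑ j, x j ^ 2 ≤ ∑ i, (A k).mulVec x i ^ 2) :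
    c ^ K * frobSq T ≤ frobSq (multiProd T A) := by
  induction K with
  | zero => simp [frobSq, multiProd]
  | succ K ih =>
    rw [frobSq_multiProd_succ, frobSq_succ T]
    calc _ = c * ∑ b, c ^ K * frobSq (fun j => T (Fin.cons b j)) := by
          rw [← Finset.mul_sum, pow_succ]; ring
      _ ≤ c * ∑ b, frobSq (multiProd (fun j => T (Fin.cons b j)) (fun k => A k.succ)) := by
          gcongr with b
          exact ih _ _ fun k x => hA k.succ x
      _ = ∑ i, c * ∑ b, multiProd (fun j => T (Fin.cons b j)) (fun k => A k.succ) i ^ 2 := by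
          rw [← Finset.mul_sum, Finset.sum_comm]; rfl
      _ ≤ _ := Finset.sum_le_sum fun i _ => hA 0 _

/-! ### Singular values as stretching factors -/

section SingularValues
open Module InnerProductSpace

variable {E F : Type*} [NormedAddCommGroup E] [InnerProductSpace ℝ E] [FiniteDimensional ℝ E]
  [NormedAddCommGroup F] [InnerProductSpace ℝ F] [FiniteDimensional ℝ F]

/-- Diagonalize `T* T`: its eigenvalues are the squared singular values. -/
lemma sq_norm_eq_sum_singularValues (T : E →ₗ[ℝ] F) {n : ℕ} (hn : finrank ℝ E = n) (x : E) :
    ‖T x‖ ^ 2 = ∑ i : Fin n, T.singularValues i ^ 2 *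
      (inner ℝ (T.isSymmetric_adjoint_comp_self.eigenvectorBasis hn i) x) ^ 2 := by
  set v := T.isSymmetric_adjoint_comp_self.eigenvectorBasis hn
  have h1 : ‖T x‖ ^ 2 = inner ℝ ((T.adjoint ∘ₗ T) x) x := by
    rw [LinearMap.comp_apply, LinearMap.adjoint_inner_left, real_inner_self_eq_norm_sq]
  rw [h1, ← v.sum_inner_mul_inner]
  refine Finset.sum_congr rfl fun i _ => ?_
  rw [T.isSymmetric_adjoint_comp_self, T.isSymmetric_adjoint_comp_self.apply_eigenvectorBasis,
    T.sq_singularValues_fin hn]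
  simp only [inner_smul_right, RCLike.ofReal_real_eq_id, id]
  rw [real_inner_comm x (v i), mul_assoc, pow_two]

lemma norm_le_singularValues_zero_mul (T : E →ₗ[ℝ] F) (x : E) :
    ‖T x‖ ≤ T.singularValues 0 * ‖x‖ := by
  refine le_of_sq_le_sq ?_ (mul_nonneg (T.singularValues_nonneg _) (norm_nonneg _))
  rw [sq_norm_eq_sum_singularValues T rfl, mul_pow,
    ← (T.isSymmetric_adjoint_comp_self.eigenvectorBasis rfl).sum_sq_inner_right, Finset.mul_sum]
  gcongr with i
  · exact T.singularValues_nonneg _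
  · exact T.singularValues_antitone (Nat.zero_le _)

/-- There is a subspace of dimension `k + 1` on which `T` stretches by at least the singular value
of (zero-based) index `k`. -/
lemma exists_submodule_singularValues_mul_le (T : E →ₗ[ℝ] F) {k : ℕ} (hk : k < finrank ℝ E) :
    ∃ V : Submodule ℝ E, finrank ℝ V = k + 1 ∧ ∀ x ∈ V, T.singularValues k * ‖x‖ ≤ ‖T x‖ := by
  set v := T.isSymmetric_adjoint_comp_self.eigenvectorBasis rfl
  let f : Fin (k + 1) → E := fun i => v (Fin.castLE hk i)
  have hf : Orthonormal ℝ f := v.orthonormal.comp _ (Fin.castLE_injective hk)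
  refine ⟨Submodule.span ℝ (Set.range f), ?_, fun x hx => ?_⟩
  · rw [finrank_span_eq_card hf.linearIndependent, Fintype.card_fin]
  · refine le_of_sq_le_sq ?_ (norm_nonneg _)
    rw [sq_norm_eq_sum_singularValues T rfl, mul_pow, ← v.sum_sq_inner_right, Finset.mul_sum]
    refine Finset.sum_le_sum fun i _ => ?_
    by_cases hi : (i : ℕ) ≤ k
    · gcongr
      · exact T.singularValues_nonneg _
      · exact T.singularValues_antitone hi
    · have h0 : inner ℝ (v i) x = 0 := by
        have : Submodule.span ℝ (Set.range f) ≤ (ℝ ∙ v i)ᗮ := by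
          rw [Submodule.span_le]
          rintro _ ⟨j, rfl⟩
          rw [SetLike.mem_coe, Submodule.mem_orthogonal_singleton_iff_inner_right]
          refine v.orthonormal.2 fun h => hi ?_
          have := congrArg Fin.val h
          simp at this
          omega
        exact (Submodule.mem_orthogonal_singleton_iff_inner_right).1 (this hx)
      rw [h0]
      simp

/-- For the last index, the stretched subspace has full dimension and is the whole space. -/
lemma singularValues_mul_le_of_finrank (T : E →ₗ[ℝ] F) {k : ℕ} (hk : k + 1 = finrank ℝ E) (x : E) :
    T.singularValues k * ‖x‖ ≤ ‖T x‖ := by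
  obtain ⟨V, hV, h⟩ := exists_submodule_singularValues_mul_le T (by omega : k < finrank ℝ E)
  exact h x (Submodule.eq_top_of_finrank_eq (hV.trans hk) ▸ Submodule.mem_top)

end SingularValues

lemma sq_norm_toEuclideanLin {m n : Type*} [Fintype m] [Fintype n] [DecidableEq n]
    (A : Matrix m n ℝ) (x : EuclideanSpace ℝ n) :
    ‖Matrix.toEuclideanLin A x‖ ^ 2 = ∑ i, A.mulVec x.ofLp i ^ 2 := by
  rw [EuclideanSpace.real_norm_sq_eq]; rfl

lemma sq_mul_le_of_le_singVal {d p : ℕ} (hp : 1 ≤ p) {A : Matrix (Fin d) (Fin p) ℝ} {c : ℝ}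
    (hc : 0 ≤ c) (h : c ≤ singVal A p) (x : Fin p → ℝ) :
    c ^ 2 * ∑ j, x j ^ 2 ≤ ∑ i, A.mulVec x i ^ 2 := by
  -- `singVal` counts from one and `singularValues` from zero, so the smallest of the `p` values has
  -- index `p - 1`.
  have h1 := singularValues_mul_le_of_finrank (Matrix.toEuclideanLin A) (k := p - 1)
    (by simp; omega) (WithLp.toLp 2 x)
  have h2 := pow_le_pow_left₀ (by positivity)
    ((mul_le_mul_of_nonneg_right h (norm_nonneg (WithLp.toLp 2 x))).trans h1) 2
  rwa [mul_pow, sq_norm_toEuclideanLin, EuclideanSpace.real_norm_sq_eq] at h2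

lemma le_sq_mul_of_singVal_le {d p : ℕ} {A : Matrix (Fin d) (Fin p) ℝ} {c : ℝ}
    (h : singVal A 1 ≤ c) (x : Fin p → ℝ) :
    ∑ i, A.mulVec x i ^ 2 ≤ c ^ 2 * ∑ j, x j ^ 2 := by
  have h1 := norm_le_singularValues_zero_mul (Matrix.toEuclideanLin A) (WithLp.toLp 2 x)
  have h2 := pow_le_pow_left₀ (by positivity)
    (h1.trans (mul_le_mul_of_nonneg_right h (norm_nonneg (WithLp.toLp 2 x)))) 2
  rwa [mul_pow, sq_norm_toEuclideanLin, EuclideanSpace.real_norm_sq_eq] at h2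

/-! ### Unfoldings and perturbation of the factors -/

lemma frobSq_eq_sum_unfold {K n : ℕ} (k : Fin K) (T : Tensor K n) :
    frobSq T = ∑ a, ∑ s, unfold k T a s ^ 2 := by
  rw [frobSq, ← Fintype.sum_prod_type' (f := fun a s => unfold k T a s ^ 2)]
  exact Fintype.sum_equiv (Equiv.funSplitAt k (Fin n)) _ _ fun i => by
    change T i ^ 2 = T ((Equiv.funSplitAt k (Fin n)).symm (Equiv.funSplitAt k (Fin n) i)) ^ 2
    rw [Equiv.symm_apply_apply]

/-- The unfolding of a Tucker product factors through the factor matrix of the same mode. -/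
lemma exists_unfold_multiProd_eq {K n m : ℕ} (k : Fin K) (T : Tensor K n)
    (A : Fin K → Matrix (Fin m) (Fin n) ℝ) :
    ∃ H : Matrix (Fin n) ({l : Fin K // l ≠ k} → Fin m) ℝ, unfold k (multiProd T A) = A k * H := by
  refine ⟨Matrix.of fun b s => ∑ t : {l : Fin K // l ≠ k} → Fin n,
    T ((Equiv.funSplitAt k (Fin n)).symm (b, t)) * ∏ l : {l : Fin K // l ≠ k}, A l (s l) (t l), ?_⟩
  ext a s
  simp only [unfold, multiProd, Matrix.mul_apply, Matrix.of_apply, Finset.mul_sum]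
  rw [← Fintype.sum_prod_type' (f := fun b (t : {l : Fin K // l ≠ k} → Fin n) =>
    A k a b * (T ((Equiv.funSplitAt k (Fin n)).symm (b, t)) *
      ∏ l : {l : Fin K // l ≠ k}, A l (s l) (t l)))]
  refine (Fintype.sum_equiv (Equiv.funSplitAt k (Fin n)).symm _ _ fun x => ?_).symm
  have h0 (l : {l : Fin K // l ≠ k}) : (l : Fin K) ≠ k := l.2
  rw [Fintype.prod_eq_mul_prod_subtype_ne _ k]
  simp only [Equiv.funSplitAt_symm_apply, dite_true, h0, dite_false]
  ring

lemma unfold_sub {K n : ℕ} (k : Fin K) (T S : Tensor K n) :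
    unfold k (T - S) = unfold k T - unfold k S := rfl

lemma sum_mulVec_sq_le {m n : Type*} [Fintype m] [Fintype n] (A : Matrix m n ℝ) (x : n → ℝ) :
    ∑ i, A.mulVec x i ^ 2 ≤ (∑ i, ∑ j, A i j ^ 2) * ∑ j, x j ^ 2 := by
  rw [Finset.sum_mul]
  exact Finset.sum_le_sum fun i _ => Finset.sum_mul_sq_le_sq_mul_sq _ _ _

lemma signal_le_singVal {K p r : ℕ} (w : Params K p r) (k : Fin K) :
    w.signal ≤ singVal (unfold k w.coef) r :=
  ciInf_le (Set.finite_range _).bddBelow k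

/-- Every vector of the column space of the true factor is the image, under the unfolding of the
true coefficient, of a vector that is shorter by a factor equal to the signal level. -/
lemma exists_unfold_coef_mulVec_eq {K p r : ℕ} (hr : 1 ≤ r) (w : Params K p r) (hw : 0 < w.signal)
    (k : Fin K) {x : EuclideanSpace ℝ (Fin p)} (hx : x ∈ colSpan (w.factor k)) :
    ∃ v, Matrix.toEuclideanLin (unfold k w.coef) v = x ∧ w.signal * ‖v‖ ≤ ‖x‖ := by
  obtain ⟨H, hH⟩ := exists_unfold_multiProd_eq k w.core w.factor
  change unfold k w.coef = _ at hH
  set T := Matrix.toEuclideanLin (unfold k w.coef)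
  have hs : w.signal ≤ T.singularValues (r - 1) := signal_le_singVal w k
  obtain ⟨V, hV, hVT⟩ := exists_submodule_singularValues_mul_le T (k := r - 1) (by
    -- Singular values beyond the dimension of the domain are zero by convention, which the positive
    -- signal excludes.
    by_contra! h
    rw [T.singularValues_of_finrank_le h] at hs
    linarith)
  have hTH (v) : T v = Matrix.toEuclideanLin (w.factor k) (Matrix.toEuclideanLin H v) := by
    simp [T, hH, Matrix.toLpLin_apply]
  obtain ⟨u, rfl⟩ := hx
  -- `T` is bounded below on `V` and factors through `H`, so `H` is injective on `V`. Both `V` and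
  -- the target have dimension `r`, hence `H` maps `V` onto it.
  have hinj : Function.Injective ((Matrix.toEuclideanLin H).domRestrict V) := by
    rw [injective_iff_map_eq_zero]
    rintro ⟨v, hv⟩ h0
    have h1 := hVT v hv
    rw [hTH, show Matrix.toEuclideanLin H v = 0 from h0, map_zero, norm_zero] at h1
    have h2 : ‖v‖ ≤ 0 := nonpos_of_mul_nonpos_right h1 (hw.trans_le hs)
    simpa using h2
  obtain ⟨⟨v, hv⟩, hvu⟩ := (LinearMap.injective_iff_surjective_of_finrank_eq_finrank
    (by simp [hV]; omega)).1 hinj u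
  change Matrix.toEuclideanLin H v = u at hvu
  refine ⟨v, by rw [hTH, hvu], ?_⟩
  rw [← hvu, ← hTH]
  exact (mul_le_mul_of_nonneg_right hs (norm_nonneg _)).trans (hVT v hv)

/-- A perturbation bound of Wedin type for the factors of a Tucker decomposition. -/
lemma sinTheta_sq_mul_signal_sq_le {K p r : ℕ} (hr : 1 ≤ r) (w₀ w : Params K p r)
    (h0 : 0 < w₀.signal) (k : Fin K) :
    sinTheta (w₀.factor k) (w.factor k) ^ 2 * w₀.signal ^ 2 ≤ frobSq (w₀.coef - w.coef) := by
  obtain ⟨H, hH⟩ := exists_unfold_multiProd_eq k w.core w.factor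
  change unfold k w.coef = _ at hH
  have key : ∀ x ∈ colSpan (w₀.factor k), ∀ y ∈ (colSpan (w.factor k))ᗮ, x ≠ 0 → y ≠ 0 →
      inner ℝ x y / (‖x‖ * ‖y‖) ≤ √(frobSq (w₀.coef - w.coef)) / w₀.signal := by
    intro x hx y hy hx0 hy0
    obtain ⟨v, rfl, hv⟩ := exists_unfold_coef_mulVec_eq hr w₀ h0 k hx
    set x := Matrix.toEuclideanLin (unfold k w₀.coef) v
    have h1 : inner ℝ x y =
        inner ℝ (Matrix.toEuclideanLin (unfold k (w₀.coef - w.coef)) v) y := by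
      rw [unfold_sub, map_sub, LinearMap.sub_apply, inner_sub_left]
      -- The estimated unfolding takes values in the estimated column space, so `y` annihilates it
      -- and only the difference of the unfoldings remains.
      have : inner ℝ (Matrix.toEuclideanLin (unfold k w.coef) v) y = 0 := by
        refine Submodule.inner_right_of_mem_orthogonal ?_ hy
        exact ⟨Matrix.toEuclideanLin H v, by simp [hH, Matrix.toLpLin_apply]⟩
      rw [this, sub_zero]
    have h2 : ‖Matrix.toEuclideanLin (unfold k (w₀.coef - w.coef)) v‖ ≤
        √(frobSq (w₀.coef - w.coef)) * ‖v‖ := by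
      refine le_of_sq_le_sq ?_ (by positivity)
      rw [mul_pow, Real.sq_sqrt (frobSq_nonneg _), sq_norm_toEuclideanLin,
        EuclideanSpace.real_norm_sq_eq, frobSq_eq_sum_unfold k]
      exact sum_mulVec_sq_le _ _
    have hxn := norm_pos_iff.2 hx0
    have hyn := norm_pos_iff.2 hy0
    rw [div_le_div_iff₀ (by positivity) h0]
    calc inner ℝ x y * w₀.signal ≤ (√(frobSq (w₀.coef - w.coef)) * ‖v‖ * ‖y‖) * w₀.signal := by
          rw [h1]
          gcongr
          exact (real_inner_le_norm _ _).trans (by gcongr)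
      _ = √(frobSq (w₀.coef - w.coef)) * ‖y‖ * (w₀.signal * ‖v‖) := by ring
      _ ≤ √(frobSq (w₀.coef - w.coef)) * ‖y‖ * ‖x‖ := by gcongr
      _ = _ := by ring
  have hle : |sinTheta (w₀.factor k) (w.factor k)| ≤
      √(frobSq (w₀.coef - w.coef)) / w₀.signal := by
    rw [abs_le]
    constructor
    -- Squaring needs a lower bound on the supremum too. The set of cosines is symmetric under `y ↦
    -- -y`, and if it is empty the supremum is `0`.
    · by_contra! hlt
      have hne : sinTheta (w₀.factor k) (w.factor k) ≠ 0 := fun h => by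
        have : 0 ≤ √(frobSq (w₀.coef - w.coef)) / w₀.signal := by positivity
        rw [h] at hlt; linarith
      obtain ⟨t, x, hx, y, hy, hx0, hy0, rfl⟩ : Set.Nonempty {t : ℝ | ∃ x ∈ colSpan (w₀.factor k),
          ∃ y ∈ (colSpan (w.factor k))ᗮ, x ≠ 0 ∧ y ≠ 0 ∧ t = inner ℝ x y / (‖x‖ * ‖y‖)} := by
        rw [Set.nonempty_iff_ne_empty]
        intro he
        exact hne (by rw [sinTheta, he, Real.sSup_empty])
      have h3 := key x hx (-y) (neg_mem hy) hx0 (neg_ne_zero.2 hy0)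
      rw [inner_neg_right, norm_neg, neg_div] at h3
      have h4 : inner ℝ x y / (‖x‖ * ‖y‖) ≤ sinTheta (w₀.factor k) (w.factor k) :=
        le_csSup ⟨√(frobSq (w₀.coef - w.coef)) / w₀.signal, by
          rintro _ ⟨x, hx, y, hy, hx0, hy0, rfl⟩
          exact key x hx y hy hx0 hy0⟩ ⟨x, hx, y, hy, hx0, hy0, rfl⟩
      linarith
    · refine Real.sSup_le ?_ (by positivity)
      rintro _ ⟨x, hx, y, hy, hx0, hy0, rfl⟩
      exact key x hx y hy hx0 hy0
  have h5 := pow_le_pow_left₀ (abs_nonneg _) hle 2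
  rw [sq_abs, div_pow, Real.sq_sqrt (frobSq_nonneg _)] at h5
  rwa [le_div_iff₀ (by positivity)] at h5

/-! ### Rank doubling and nets -/

/-- Two matrices with `r` columns have their columns fixed by `N Nᵀ` for a contraction `N` with
`r + r` columns. -/
lemma exists_contraction_mul_transpose_fix {p r : ℕ} (A B : Matrix (Fin p) (Fin r) ℝ) :
    ∃ N : Matrix (Fin p) (Fin (r + r)) ℝ, N * N.transpose * A = A ∧ N * N.transpose * B = B ∧
      ∀ x, ∑ j, N.transpose.mulVec x j ^ 2 ≤ ∑ i, x i ^ 2 := by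
  let f : Fin (r + r) → EuclideanSpace ℝ (Fin p) :=
    Fin.append (fun j => WithLp.toLp 2 (A.col j)) (fun j => WithLp.toLp 2 (B.col j))
  let E := Submodule.span ℝ (Set.range f)
  have hE : Module.finrank ℝ E ≤ r + r := (finrank_range_le_card f).trans (by simp)
  let b := stdOrthonormalBasis ℝ E
  let e := Fin.castLE hE
  have he : Function.Injective e := Fin.castLE_injective hE
  -- The joint column span may have dimension below `r + r`; its orthonormal basis is padded with
  -- zeros. This is why `N` is only a contraction.
  let g : Fin (r + r) → EuclideanSpace ℝ (Fin p) :=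
    Function.extend e (fun i => (b i : EuclideanSpace ℝ (Fin p))) 0
  have hg (i) : g (e i) = b i := he.extend_apply _ _ _
  have hg0 (j) (hj : j ∉ Set.range e) : g j = 0 := Function.extend_apply' _ _ _ hj
  let N : Matrix (Fin p) (Fin (r + r)) ℝ := Matrix.of fun i j => (g j).ofLp i
  have hN (x : EuclideanSpace ℝ (Fin p)) (j) : N.transpose.mulVec x.ofLp j = inner ℝ (g j) x := by
    simp [N, Matrix.mulVec, dotProduct, PiLp.inner_apply, mul_comm]
  have hfix (x : EuclideanSpace ℝ (Fin p)) (hx : x ∈ E) (i) :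
      (N * N.transpose).mulVec x.ofLp i = x.ofLp i := by
    have h1 := congrArg (fun z : E => (z : EuclideanSpace ℝ (Fin p)).ofLp i)
      (b.sum_repr' ⟨x, hx⟩)
    simp only [Submodule.coe_sum, WithLp.ofLp_sum, Finset.sum_apply, Submodule.coe_smul,
      Submodule.coe_inner, PiLp.smul_apply, smul_eq_mul] at h1
    rw [← Matrix.mulVec_mulVec]
    change ∑ j, N i j * N.transpose.mulVec x.ofLp j = _
    rw [← h1]
    symm
    refine Fintype.sum_of_injective e he _ _ (fun j hj => ?_) fun j => ?_
    · simp [N, hg0 j hj]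
    · rw [hN, hg]
      simp only [N, Matrix.of_apply, hg, mul_comm]
  refine ⟨N, ?_, ?_, fun x => ?_⟩
  · ext i j
    have := hfix (f (Fin.castAdd r j)) (Submodule.subset_span ⟨_, rfl⟩) i
    simpa [f, Matrix.mulVec, dotProduct, Matrix.mul_apply (M := N * N.transpose)] using this
  · ext i j
    have := hfix (f (Fin.natAdd r j)) (Submodule.subset_span ⟨_, rfl⟩) i
    rw [show f (Fin.natAdd r j) = WithLp.toLp 2 (B.col j) from Fin.append_right _ _ j] at this
    simpa [Matrix.mulVec, dotProduct, Matrix.mul_apply (M := N * N.transpose)] using this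
  · have h1 : ∑ j, N.transpose.mulVec x j ^ 2 =
        ∑ i, inner ℝ (b i : EuclideanSpace ℝ (Fin p)) (WithLp.toLp 2 x) ^ 2 := by
      symm
      refine Fintype.sum_of_injective e he _ _ (fun j hj => ?_) fun j => ?_
      · rw [show x = (WithLp.toLp 2 x).ofLp from rfl, hN, hg0 j hj]; simp
      · rw [show N.transpose.mulVec x (e j) = _ from hN (WithLp.toLp 2 x) (e j), hg]
    have ho : Orthonormal ℝ fun i => (b i : EuclideanSpace ℝ (Fin p)) :=
      b.orthonormal.comp_linearIsometry E.subtypeₗᵢ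
    have h2 := ho.sum_inner_products_le (WithLp.toLp 2 x) (s := Finset.univ)
    rw [EuclideanSpace.real_norm_sq_eq] at h2
    simpa only [h1, Real.norm_eq_abs, sq_abs] using h2

section Nets
variable {E : Type*} [NormedAddCommGroup E] [NormedSpace ℝ E] [FiniteDimensional ℝ E]

open Metric Module in
/-- A `δ`-separated subset of the unit ball has at most `(1 + 2 / δ) ^ dim` elements. -/
lemma card_le_of_separated {δ : ℝ} (hδ : 0 < δ) (s : Finset E) (hs : ∀ c ∈ s, ‖c‖ ≤ 1)
    (h : ∀ c ∈ s, ∀ d ∈ s, c ≠ d → δ ≤ ‖c - d‖) :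
    (s.card : ℝ) ≤ (1 + 2 / δ) ^ finrank ℝ E := by
  borelize E
  let μ : Measure E := Measure.addHaar
  have hδ2 : 0 < δ / 2 := half_pos hδ
  have hρ : 0 < 1 + δ / 2 := by positivity
  -- Volume comparison: the balls of radius `δ / 2` are disjoint and lie in a ball of radius `1 + δ
  -- / 2`.
  have hdisj : Set.Pairwise (s : Set E) (Function.onFun Disjoint fun c => ball c (δ / 2)) := by
    rintro c hc d hd hcd
    refine ball_disjoint_ball ?_
    rw [dist_eq_norm, add_halves]
    exact h c hc d hd hcd
  have hsub : (⋃ c ∈ s, ball c (δ / 2)) ⊆ ball (0 : E) (1 + δ / 2) := by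
    refine Set.iUnion₂_subset fun x hx => ball_subset_ball' ?_
    rw [dist_zero_right, add_comm]
    exact add_le_add_left (hs x hx) _
  have hvol : (s.card : ℝ≥0∞) * ENNReal.ofReal ((δ / 2) ^ finrank ℝ E) * μ (ball 0 1) ≤
      ENNReal.ofReal ((1 + δ / 2) ^ finrank ℝ E) * μ (ball 0 1) :=
    calc _ = μ (⋃ c ∈ s, ball c (δ / 2)) := by
          rw [measure_biUnion_finset hdisj fun c _ => measurableSet_ball]
          simp only [μ.addHaar_ball_of_pos _ hδ2, Finset.sum_const, nsmul_eq_mul, mul_assoc]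
      _ ≤ μ (ball (0 : E) (1 + δ / 2)) := measure_mono hsub
      _ = _ := by simp only [μ.addHaar_ball_of_pos _ hρ]
  have h1 := (ENNReal.mul_le_mul_iff_left (measure_ball_pos _ _ zero_lt_one).ne'
    measure_ball_lt_top.ne).1 hvol
  have h2 := ENNReal.toReal_le_of_le_ofReal (pow_nonneg hρ.le _) h1
  rw [ENNReal.toReal_mul, ENNReal.toReal_natCast, ENNReal.toReal_ofReal (by positivity),
    ← le_div_iff₀ (by positivity), ← div_pow] at h2
  rwa [show (1 + δ / 2) / (δ / 2) = 1 + 2 / δ by field_simp; ring] at h2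

open Module in
/-- Every subset of the unit ball has a `δ`-net of at most `(1 + 2 / δ) ^ dim` elements. -/
lemma exists_net {δ : ℝ} (hδ : 0 < δ) (A : Set E) (hA : ∀ x ∈ A, ‖x‖ ≤ 1) :
    ∃ s : Finset E, (∀ x ∈ s, x ∈ A) ∧ (s.card : ℝ) ≤ (1 + 2 / δ) ^ finrank ℝ E ∧
      ∀ x ∈ A, ∃ c ∈ s, ‖x - c‖ ≤ δ := by
  classical
  -- A separated subset of maximal size is a net: a point far from all its elements could be added.
  let Q : Set ℕ := {n | ∃ s : Finset E, s.card = n ∧ (∀ x ∈ s, x ∈ A) ∧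
    ∀ c ∈ s, ∀ d ∈ s, c ≠ d → δ ≤ ‖c - d‖}
  have hQ : BddAbove Q := by
    refine ⟨⌊(1 + 2 / δ) ^ finrank ℝ E⌋₊, ?_⟩
    rintro _ ⟨s, rfl, hs, hsep⟩
    exact Nat.le_floor (card_le_of_separated hδ s (fun c hc => hA c (hs c hc)) hsep)
  obtain ⟨s, hcard, hs, hsep⟩ := Nat.sSup_mem (s := Q) ⟨0, ∅, by simp⟩ hQ
  refine ⟨s, hs, card_le_of_separated hδ s (fun c hc => hA c (hs c hc)) hsep, fun x hx => ?_⟩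
  by_contra! hfar
  have hxs : x ∉ s := fun h => by simpa using (hfar x h).trans_le' hδ.le
  have hmem : s.card + 1 ∈ Q := by
    refine ⟨insert x s, Finset.card_insert_of_notMem hxs, ?_, ?_⟩
    · intro y hy
      rcases Finset.mem_insert.1 hy with rfl | hy
      exacts [hx, hs y hy]
    · intro c hc d hd hcd
      rcases Finset.mem_insert.1 hc with hcx | hc <;> rcases Finset.mem_insert.1 hd with hdx | hd
      · exact (hcd (hcx.trans hdx.symm)).elim
      · rw [hcx]; exact (hfar d hd).le
      · rw [hdx, norm_sub_rev]; exact (hfar c hc).le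
      · exact hsep c hc d hd hcd
  have := le_csSup hQ hmem
  omega

lemma exists_half_net (E : Type*) [NormedAddCommGroup E] [NormedSpace ℝ E]
    [FiniteDimensional ℝ E] :
    ∃ s : Finset E, (∀ x ∈ s, ‖x‖ ≤ 1) ∧ s.card ≤ 5 ^ Module.finrank ℝ E ∧
      ∀ x : E, ‖x‖ ≤ 1 → ∃ c ∈ s, ‖x - c‖ ≤ 1 / 2 := by
  obtain ⟨s, h1, h2, h3⟩ := exists_net (E := E) (δ := 1 / 2) (by norm_num) {x | ‖x‖ ≤ 1}
    fun _ h => h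
  refine ⟨s, h1, ?_, h3⟩
  norm_num at h2
  exact_mod_cast h2

/-- Approximating a unit vector from the net gives `‖g‖ ≤ t + ‖g‖ / 2`, and the last term is
absorbed on the left. -/
lemma abs_le_two_mul_of_net (f : E →ₗ[ℝ] ℝ) {s : Finset E} {t : ℝ}
    (hs : ∀ x : E, ‖x‖ ≤ 1 → ∃ c ∈ s, ‖x - c‖ ≤ 1 / 2) (ht : ∀ c ∈ s, |f c| ≤ t) {x : E}
    (hx : ‖x‖ ≤ 1) : |f x| ≤ 2 * t := by
  let g := LinearMap.toContinuousLinearMap f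
  have h0 : 0 ≤ t := by
    obtain ⟨c, hc, -⟩ := hs 0 (by simp)
    exact (abs_nonneg _).trans (ht c hc)
  have h1 : ‖g‖ ≤ t + ‖g‖ / 2 := by
    refine g.opNorm_le_of_unit_norm (by positivity) fun y hy => ?_
    obtain ⟨c, hc, hyc⟩ := hs y hy.le
    calc ‖g y‖ = ‖g c + g (y - c)‖ := by rw [← map_add]; simp
      _ ≤ ‖g c‖ + ‖g (y - c)‖ := norm_add_le _ _
      _ ≤ t + ‖g‖ * (1 / 2) := add_le_add (ht c hc) ((g.le_opNorm _).trans (by gcongr))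
      _ = _ := by ring
  calc |f x| ≤ ‖g‖ * ‖x‖ := g.le_opNorm x
    _ ≤ ‖g‖ * 1 := by gcongr
    _ ≤ 2 * t := by linarith

/-- The arguments are released from the net to the unit ball one by one; each release uses linearity
in that slot and costs a factor 2. -/
lemma abs_le_two_pow_mul_of_net {ι : Type*} [Fintype ι] (f : MultilinearMap ℝ (fun _ : ι => E) ℝ)
    {s : Finset E} {t : ℝ} (hs : ∀ x : E, ‖x‖ ≤ 1 → ∃ c ∈ s, ‖x - c‖ ≤ 1 / 2)
    (ht : ∀ v : ι → E, (∀ k, v k ∈ s) → |f v| ≤ t) (v : ι → E) (hv : ∀ k, ‖v k‖ ≤ 1) :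
    |f v| ≤ 2 ^ Fintype.card ι * t := by
  classical
  have key : ∀ u : Finset ι, ∀ v : ι → E, (∀ k ∈ u, ‖v k‖ ≤ 1) → (∀ k ∉ u, v k ∈ s) →
      |f v| ≤ 2 ^ u.card * t := by
    intro u
    induction u using Finset.induction_on with
    | empty => intro v _ hv; simpa using ht v fun k => hv k (by simp)
    | insert a u ha ih =>
      intro v hv1 hv2
      rw [Finset.card_insert_of_notMem ha, pow_succ', mul_assoc]
      have h1 := abs_le_two_mul_of_net (f.toLinearMap v a) hs (t := 2 ^ u.card * t)
        (fun c hc => ?_) (hv1 a (Finset.mem_insert_self _ _))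
      · simpa using h1
      · refine ih _ (fun k hk => ?_) fun k hk => ?_
        · rw [Function.update_of_ne (by rintro rfl; exact ha hk)]
          exact hv1 k (Finset.mem_insert_of_mem hk)
        · by_cases hka : k = a
          · subst hka; simpa using hc
          · rw [Function.update_of_ne hka]
            exact hv2 k (by simp [hka, hk])
  simpa using key Finset.univ v (fun k _ => hv k) (by simp)

end Nets

/-! ### Nets of Tucker decompositions -/

/-- The multilinear form `(N₁, …, N_K) ↦ ⟨e, G × {z₁ N₁, …, z_K N_K}⟩`. -/
def factorForm {K d p q : ℕ} (e : Tensor K d) (z : Fin K → Matrix (Fin d) (Fin p) ℝ)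
    (G : Tensor K q) : MultilinearMap ℝ (fun _ : Fin K => Matrix (Fin p) (Fin q) ℝ) ℝ :=
  ∑ i, ∑ j, (e i * G j) • (MultilinearMap.mkPiAlgebra ℝ (Fin K) ℝ).compLinearMap fun k =>
    (Matrix.entryLinearMap ℝ ℝ (i k) (j k)).comp
      (mulLeftLinearMap (Fin q) ℝ (z k))

lemma factorForm_apply {K d p q : ℕ} (e : Tensor K d) (z : Fin K → Matrix (Fin d) (Fin p) ℝ)
    (G : Tensor K q) (N : Fin K → Matrix (Fin p) (Fin q) ℝ) :
    factorForm e z G N = ∑ i, e i * multiProd G (fun k => z k * N k) i := by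
  simp [factorForm, multiProd, sum_apply, Finset.mul_sum, mul_assoc]

/-- The linear form `G ↦ ⟨e, G × {A₁, …, A_K}⟩`. -/
def coreForm {K d q : ℕ} (e : Tensor K d) (A : Fin K → Matrix (Fin d) (Fin q) ℝ) :
    EuclideanSpace ℝ (Fin K → Fin q) →ₗ[ℝ] ℝ where
  toFun G := ∑ i, e i * multiProd G.ofLp A i
  map_add' G H := by simp [multiProd, add_mul, mul_add, Finset.sum_add_distrib]
  map_smul' c G := by
    simp only [multiProd, Finset.mul_sum, PiLp.smul_apply, smul_eq_mul, RingHom.id_apply]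
    exact Finset.sum_congr rfl fun _ _ => Finset.sum_congr rfl fun _ _ => by ring

open scoped Matrix.Norms.L2Operator in
lemma sum_mulVec_sq_le_of_opNorm_le_one {p q : ℕ} {N : Matrix (Fin p) (Fin q) ℝ} (hN : ‖N‖ ≤ 1)
    (x : Fin q → ℝ) : ∑ i, N.mulVec x i ^ 2 ≤ ∑ j, x j ^ 2 := by
  have h := Matrix.l2_opNorm_mulVec N (WithLp.toLp 2 x)
  have h2 := pow_le_pow_left₀ (norm_nonneg _)
    (h.trans (mul_le_of_le_one_left (norm_nonneg _) hN)) 2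
  rwa [EuclideanSpace.real_norm_sq_eq, EuclideanSpace.real_norm_sq_eq] at h2

open scoped Matrix.Norms.L2Operator in
lemma opNorm_le_one_of_transpose {p q : ℕ} {N : Matrix (Fin p) (Fin q) ℝ}
    (hN : ∀ x, ∑ j, N.transpose.mulVec x j ^ 2 ≤ ∑ i, x i ^ 2) : ‖N‖ ≤ 1 := by
  rw [← Matrix.l2_opNorm_conjTranspose, Matrix.conjTranspose_eq_transpose_of_trivial,
    Matrix.l2_opNorm_def]
  refine ContinuousLinearMap.opNorm_le_bound _ zero_le_one fun x => ?_
  rw [one_mul]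
  refine le_of_sq_le_sq ?_ (norm_nonneg _)
  rw [EuclideanSpace.real_norm_sq_eq, EuclideanSpace.real_norm_sq_eq]
  exact hN _

open scoped Matrix.Norms.L2Operator in
/-- A finite family of Tucker decompositions on which it suffices to bound a linear functional of
the tensor in order to bound it for all Tucker decompositions. -/
lemma exists_tucker_net (K p q : ℕ) :
    ∃ S : Finset (Tensor K q × (Fin K → Matrix (Fin p) (Fin q) ℝ)),
      S.card ≤ 5 ^ (q ^ K + K * (p * q)) ∧
      (∀ s ∈ S, frobSq s.1 ≤ 1 ∧ ∀ k x, ∑ i, (s.2 k).mulVec x i ^ 2 ≤ ∑ j, x j ^ 2) ∧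
      ∀ (d : ℕ) (z : Fin K → Matrix (Fin d) (Fin p) ℝ) (e : Tensor K d) (t : ℝ),
        (∀ s ∈ S, |∑ i, e i * multiProd s.1 (fun k => z k * s.2 k) i| ≤ t) →
        ∀ (G : Tensor K q) (N : Fin K → Matrix (Fin p) (Fin q) ℝ),
          (∀ k x, ∑ j, (N k).transpose.mulVec x j ^ 2 ≤ ∑ i, x i ^ 2) →
          |∑ i, e i * multiProd G (fun k => z k * N k) i| ≤ 2 ^ (K + 1) * t * √(frobSq G) := by
  classical
  obtain ⟨S₁, h1, h1c, h1n⟩ := exists_half_net (EuclideanSpace ℝ (Fin K → Fin q))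
  -- The norm on matrices is the operator norm, whose unit ball contains every contraction. The size
  -- of the net depends only on the dimension `p * q`.
  obtain ⟨S₂, h2, h2c, h2n⟩ := exists_half_net (Matrix (Fin p) (Fin q) ℝ)
  have hnorm (G : EuclideanSpace ℝ (Fin K → Fin q)) : frobSq G.ofLp = ‖G‖ ^ 2 := by
    rw [EuclideanSpace.real_norm_sq_eq]; rfl
  refine ⟨(S₁.image WithLp.ofLp) ×ˢ Fintype.piFinset fun _ => S₂, ?_, ?_, ?_⟩
  · rw [Finset.card_product, Fintype.card_piFinset_const, pow_add]
    refine Nat.mul_le_mul ?_ ?_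
    · refine Finset.card_image_le.trans (h1c.trans_eq ?_)
      simp
    · rw [mul_comm K, pow_mul]
      refine Nat.pow_le_pow_left (h2c.trans_eq ?_) _
      simp [Module.finrank_matrix]
  · rintro ⟨G, N⟩ hs
    simp only [Finset.mem_product, Finset.mem_image, Fintype.mem_piFinset] at hs
    obtain ⟨⟨G, hG, rfl⟩, hN⟩ := hs
    refine ⟨?_, fun k x => sum_mulVec_sq_le_of_opNorm_le_one (h2 _ (hN k)) x⟩
    rw [hnorm]
    exact pow_le_one₀ (norm_nonneg _) (h1 _ hG)
  · intro d z e t ht G N hN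
    have hunit (H : EuclideanSpace ℝ (Fin K → Fin q)) (hH : ‖H‖ ≤ 1) :
        |coreForm e (fun k => z k * N k) H| ≤ 2 ^ (K + 1) * t := by
      -- One factor 2 is paid for the core and `K` more for the factors.
      rw [pow_succ', mul_assoc]
      refine abs_le_two_mul_of_net _ h1n (fun c hc => ?_) hH
      change |∑ i, e i * multiProd c.ofLp (fun k => z k * N k) i| ≤ _
      rw [← factorForm_apply]
      have := abs_le_two_pow_mul_of_net (factorForm e z c.ofLp) h2n (t := t) (fun v hv => ?_) N
        fun k => opNorm_le_one_of_transpose (hN k)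
      · simpa using this
      · rw [factorForm_apply]
        exact ht (c.ofLp, v) (by simpa using ⟨⟨c, hc, rfl⟩, hv⟩)
    let H : EuclideanSpace ℝ (Fin K → Fin q) := WithLp.toLp 2 G
    have hH : √(frobSq G) = ‖H‖ := by
      rw [show frobSq G = _ from hnorm H, Real.sqrt_sq (norm_nonneg _)]
    change |coreForm e (fun k => z k * N k) H| ≤ _
    rw [hH]
    by_cases h0 : H = 0
    · simp [h0]
    · have hpos : 0 < ‖H‖ := norm_pos_iff.2 h0
      have h3 := hunit (‖H‖⁻¹ • H) (by rw [norm_smul]; simp [h0])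
      rw [map_smul, smul_eq_mul, abs_mul, abs_of_pos (inv_pos.2 hpos), inv_mul_le_iff₀ hpos] at h3
      linarith

/-! ### Exponential families: smoothness, curvature and concentration -/

section ExponentialFamily
open Set

variable {ν : Measure ℝ} {b : ℝ → ℝ} {φ : ℝ}

lemma IsExpFamily.lintegral_eq_one (h : IsExpFamily ν b φ) (θ : ℝ) :
    ∫⁻ y, ENNReal.ofReal (Real.exp ((y * θ - b θ) / φ)) ∂ν = 1 := by
  have := (h.2 θ).measure_univ
  rwa [expFamLaw, withDensity_apply _ MeasurableSet.univ, Measure.restrict_univ] at this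

/-- At `θ = 0` the density is a positive constant. -/
lemma IsExpFamily.isFiniteMeasure (h : IsExpFamily ν b φ) : IsFiniteMeasure ν := by
  have h1 := h.lintegral_eq_one 0
  simp only [mul_zero, lintegral_const] at h1
  refine ⟨lt_top_iff_ne_top.2 fun htop => ?_⟩
  rw [htop, ENNReal.mul_top (by simp [Real.exp_pos])] at h1
  exact ENNReal.top_ne_one h1

lemma IsExpFamily.integrable_density (h : IsExpFamily ν b φ) (θ : ℝ) :
    Integrable (fun y => Real.exp ((y * θ - b θ) / φ)) ν := by
  refine ⟨by fun_prop, ?_⟩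
  rw [hasFiniteIntegral_iff_ofReal (ae_of_all _ fun _ => (Real.exp_pos _).le),
    h.lintegral_eq_one]
  exact ENNReal.one_lt_top

lemma IsExpFamily.exp_mul_eq (h : IsExpFamily ν b φ) (t y : ℝ) :
    Real.exp (t * y) = Real.exp (b (φ * t) / φ) * Real.exp ((y * (φ * t) - b (φ * t)) / φ) := by
  have := h.1.ne'
  rw [← Real.exp_add]
  congr 1
  field_simp
  ring

lemma IsExpFamily.integrable_exp_mul (h : IsExpFamily ν b φ) (t : ℝ) :
    Integrable (fun y => Real.exp (t * y)) ν := by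
  simp_rw [h.exp_mul_eq t]
  exact (h.integrable_density _).const_mul _

/-- The normalization of the density at `φ t` is exactly this identity; it makes `b` a rescaled
cumulant generating function. -/
lemma IsExpFamily.mgf_eq (h : IsExpFamily ν b φ) (t : ℝ) :
    mgf id ν t = Real.exp (b (φ * t) / φ) := by
  simp only [mgf, id]
  simp_rw [h.exp_mul_eq t]
  rw [integral_const_mul, integral_eq_lintegral_of_nonneg_ae
    (ae_of_all _ fun _ => (Real.exp_pos _).le) (by fun_prop), h.lintegral_eq_one]
  simp

lemma IsExpFamily.eq_cgf (h : IsExpFamily ν b φ) : b = fun θ => φ * cgf id ν (φ⁻¹ * θ) := by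
  have := h.1.ne'
  funext θ
  rw [cgf, h.mgf_eq, Real.log_exp, mul_inv_cancel_left₀ this]
  field_simp

/-- All exponential moments of `ν` are finite, so its cumulant generating function is analytic on
the whole line. -/
lemma IsExpFamily.contDiff (h : IsExpFamily ν b φ) : ContDiff ℝ 2 b := by
  have h1 : interior (integrableExpSet id ν) = univ := by
    have : integrableExpSet id ν = univ := eq_univ_of_forall fun t => h.integrable_exp_mul t
    rw [this, interior_univ]
  have h2 : ContDiff ℝ 2 (cgf id ν) := by
    rw [contDiff_iff_contDiffAt]
    exact fun t => (analyticAt_cgf (by rw [h1]; trivial)).contDiffAt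
  rw [h.eq_cgf]
  fun_prop

/-- Second-order Taylor expansion with Lagrange remainder. -/
lemma exists_taylor_two {f : ℝ → ℝ} (hf : ContDiff ℝ 2 f) (x y : ℝ) :
    ∃ ξ ∈ uIcc x y, f y = f x + deriv f x * (y - x) + deriv (deriv f) ξ / 2 * (y - x) ^ 2 := by
  rcases eq_or_ne x y with rfl | hxy
  · exact ⟨x, left_mem_uIcc, by simp⟩
  obtain ⟨ξ, hξ, h⟩ := taylor_mean_remainder_lagrange_iteratedDeriv (n := 1) hxy
    (by norm_num; exact hf.contDiffOn)
  refine ⟨ξ, Ioo_subset_Icc_self hξ, ?_⟩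
  have h1 : derivWithin f (uIcc x y) x = deriv f x :=
    ((hf.differentiable (by norm_num)) x).derivWithin
      (uniqueDiffOn_uIcc hxy x left_mem_uIcc)
  rw [taylorWithinEval_succ, taylor_within_zero_eval, iteratedDerivWithin_one, h1,
    show (1 : ℕ) + 1 = 2 from rfl, iteratedDeriv_succ, iteratedDeriv_one] at h
  simp at h
  linarith

lemma CurvatureBounds.sub_le {α : ℝ≥0∞} {L U : ℝ} (hc : CurvatureBounds b α L U)
    (hb : ContDiff ℝ 2 b) (x y : ℝ) :
    b y - b x - deriv b x * (y - x) ≤ U / 2 * (y - x) ^ 2 := by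
  obtain ⟨ξ, -, h⟩ := exists_taylor_two hb x y
  have := mul_le_mul_of_nonneg_right (hc.2 ξ) (sq_nonneg (y - x))
  linarith

lemma CurvatureBounds.le_sub {α : ℝ≥0∞} {L U : ℝ} (hc : CurvatureBounds b α L U)
    (hb : ContDiff ℝ 2 b) {x y : ℝ} (hx : ENNReal.ofReal |x| ≤ α) (hy : ENNReal.ofReal |y| ≤ α) :
    L / 2 * (y - x) ^ 2 ≤ b y - b x - deriv b x * (y - x) := by
  obtain ⟨ξ, hξ, h⟩ := exists_taylor_two hb x y
  have h1 : ENNReal.ofReal |ξ| ≤ α := by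
    have h2 : |ξ| ≤ max |x| |y| := by
      rcases mem_uIcc.1 hξ with h | h
      · exact abs_le_max_abs_abs h.1 h.2
      · rw [max_comm]; exact abs_le_max_abs_abs h.1 h.2
    rcases le_max_iff.1 h2 with h2 | h2
    · exact (ENNReal.ofReal_le_ofReal h2).trans hx
    · exact (ENNReal.ofReal_le_ofReal h2).trans hy
  have := mul_le_mul_of_nonneg_right (hc.1 ξ h1) (sq_nonneg (y - x))
  linarith

lemma integral_expFamLaw (θ : ℝ) (f : ℝ → ℝ) :
    ∫ y, f y ∂expFamLaw ν b φ θ = ∫ y, Real.exp ((y * θ - b θ) / φ) * f y ∂ν := by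
  rw [expFamLaw, integral_withDensity_eq_integral_toReal_smul₀ (by fun_prop)
    (ae_of_all _ fun _ => ENNReal.ofReal_lt_top)]
  simp [ENNReal.toReal_ofReal (Real.exp_pos _).le]

lemma integrable_expFamLaw_iff (θ : ℝ) (f : ℝ → ℝ) :
    Integrable f (expFamLaw ν b φ θ) ↔
      Integrable (fun y => Real.exp ((y * θ - b θ) / φ) * f y) ν := by
  rw [expFamLaw, integrable_withDensity_iff_integrable_smul₀' (by fun_prop)
    (ae_of_all _ fun _ => ENNReal.ofReal_lt_top)]
  simp [ENNReal.toReal_ofReal (Real.exp_pos _).le]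

lemma IsExpFamily.density_mul_exp (h : IsExpFamily ν b φ) (θ m t y : ℝ) :
    Real.exp ((y * θ - b θ) / φ) * Real.exp (t * (y - m)) =
      Real.exp (-b θ / φ - t * m) * Real.exp ((t + φ⁻¹ * θ) * y) := by
  have := h.1.ne'
  rw [← Real.exp_add, ← Real.exp_add]
  congr 1
  field_simp
  ring

/-- The log-mgf at `t` is the first-order Taylor remainder of `b` between `θ` and `θ + φ t`, divided
by `φ`. As `t` is arbitrary, the upper curvature bound is needed on all of `ℝ`. -/
lemma IsExpFamily.hasSubgaussianMGF (h : IsExpFamily ν b φ) {α : ℝ≥0∞} {L U : ℝ}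
    (hc : CurvatureBounds b α L U) (hU : 0 ≤ U) (θ : ℝ) :
    HasSubgaussianMGF (fun y => y - deriv b θ) (U * φ).toNNReal (expFamLaw ν b φ θ) where
  integrable_exp_mul t := by
    rw [integrable_expFamLaw_iff]
    simp_rw [h.density_mul_exp]
    exact (h.integrable_exp_mul _).const_mul _
  mgf_le t := by
    have hφ := h.1
    rw [mgf, integral_expFamLaw]
    simp_rw [h.density_mul_exp]
    rw [integral_const_mul]
    change _ * mgf id ν _ ≤ _
    rw [h.mgf_eq, ← Real.exp_add, Real.exp_le_exp, Real.coe_toNNReal _ (by positivity)]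
    have h1 := hc.sub_le h.contDiff θ (θ + φ * t)
    rw [show φ * (t + φ⁻¹ * θ) = θ + φ * t by field_simp; ring]
    calc _ = (b (θ + φ * t) - b θ - deriv b θ * (θ + φ * t - θ)) / φ := by field_simp; ring
      _ ≤ (U / 2 * (θ + φ * t - θ) ^ 2) / φ := by gcongr
      _ = _ := by field_simp; ring

lemma HasSubgaussianMGF.mono {Ω : Type*} [MeasurableSpace Ω] {μ : Measure Ω} {X : Ω → ℝ}
    {c c' : NNReal} (h : HasSubgaussianMGF X c μ) (hcc : c ≤ c') : HasSubgaussianMGF X c' μ :=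
  ⟨h.1, fun t => (h.2 t).trans (by gcongr)⟩

lemma IsExpFamily.measure_pi_abs_sum_gt_le (h : IsExpFamily ν b φ) {α : ℝ≥0∞} {L U : ℝ}
    (hc : CurvatureBounds b α L U) (hU : 0 ≤ U) {ι : Type*} [Fintype ι] (θ a : ι → ℝ) {V t : ℝ}
    (ha : ∑ i, a i ^ 2 ≤ V) (ht : 0 ≤ t) :
    Measure.pi (fun i => expFamLaw ν b φ (θ i)) {y | t < |∑ i, (y i - deriv b (θ i)) * a i|} ≤
      ENNReal.ofReal (2 * Real.exp (-t ^ 2 / (2 * (U * φ * V)))) := by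
  have hφ := h.1
  have hprob (i : ι) : IsProbabilityMeasure (expFamLaw ν b φ (θ i)) := h.2 (θ i)
  set μ := Measure.pi (fun i => expFamLaw ν b φ (θ i))
  have hV : 0 ≤ V := (Finset.sum_nonneg fun i _ => sq_nonneg (a i)).trans ha
  have hind : iIndepFun (fun i (y : ι → ℝ) => a i * (y i - deriv b (θ i))) μ :=
    iIndepFun_pi (X := fun i (y : ℝ) => a i * (y - deriv b (θ i))) fun i => by fun_prop
  have hsub (i : ι) : HasSubgaussianMGF (fun y : ι → ℝ => a i * (y i - deriv b (θ i)))
      (a i ^ 2 * (U * φ)).toNNReal μ := by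
    refine HasSubgaussianMGF.mono (HasSubgaussianMGF.const_mul
      (X := fun y : ι → ℝ => y i - deriv b (θ i)) (c := (U * φ).toNNReal) ?_ (a i)) ?_
    swap
    · rw [← NNReal.coe_le_coe, Real.coe_toNNReal _ (by positivity)]
      change a i ^ 2 * ((U * φ).toNNReal : ℝ) ≤ _
      rw [Real.coe_toNNReal _ (by positivity)]
    have h1 := h.hasSubgaussianMGF hc hU (θ i)
    have h2 : expFamLaw ν b φ (θ i) = μ.map (fun y => y i) :=
      (measurePreserving_eval (fun i => expFamLaw ν b φ (θ i)) i).map_eq.symm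
    rw [h2] at h1
    have h3 : AEMeasurable (fun y : ι → ℝ => y i) μ := (measurable_pi_apply i).aemeasurable
    exact h1.of_map h3
  have hsum : HasSubgaussianMGF (fun y : ι → ℝ => ∑ i, a i * (y i - deriv b (θ i)))
      (U * φ * V).toNNReal μ := by
    refine HasSubgaussianMGF.mono
      (HasSubgaussianMGF.sum_of_iIndepFun hind (s := Finset.univ) fun i _ => hsub i) ?_
    rw [← NNReal.coe_le_coe, Real.coe_toNNReal _ (by positivity)]
    rw [NNReal.coe_sum, Finset.sum_congr rfl fun i _ => Real.coe_toNNReal (a i ^ 2 * (U * φ))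
      (by positivity), ← Finset.sum_mul, mul_comm]
    gcongr
  have h1 := hsum.measure_ge_le ht
  have h2 := hsum.neg.measure_ge_le ht
  rw [Real.coe_toNNReal _ (by positivity)] at h1 h2
  have hsubset : {y : ι → ℝ | t < |∑ i, (y i - deriv b (θ i)) * a i|} ⊆
      {y | t ≤ ∑ i, a i * (y i - deriv b (θ i))} ∪
        {y | t ≤ (-fun y : ι → ℝ => ∑ i, a i * (y i - deriv b (θ i))) y} := by
    intro y hy
    simp only [mem_ofPred_eq, mul_comm _ (a _)] at hy
    rcases lt_abs.1 hy with hy | hy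
    · exact Or.inl hy.le
    · exact Or.inr hy.le
  rw [two_mul, ENNReal.ofReal_add (Real.exp_pos _).le (Real.exp_pos _).le]
  refine (measure_mono hsubset).trans ((measure_union_le _ _).trans (add_le_add ?_ ?_))
  · rw [← ofReal_measureReal]
    exact ENNReal.ofReal_le_ofReal h1
  · rw [← ofReal_measureReal]
    exact ENNReal.ofReal_le_ofReal h2

lemma IsExpFamily.measurable_expFamLaw_apply (h : IsExpFamily ν b φ) {s : Set ℝ}
    (hs : MeasurableSet s) : Measurable fun θ => expFamLaw ν b φ θ s := by
  have := h.isFiniteMeasure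
  have hb : Measurable b := h.contDiff.continuous.measurable
  simp only [expFamLaw, withDensity_apply _ hs]
  exact Measurable.lintegral_prod_right'
    (f := fun x : ℝ × ℝ => ENNReal.ofReal (Real.exp ((x.2 * x.1 - b x.1) / φ))) (by fun_prop)

end ExponentialFamily

/-! ### Conditioning on the features -/

section Model
variable {K d p : ℕ} {ν : Measure ℝ} {b : ℝ → ℝ} {φ : ℝ}

lemma measurable_multiProd {q : ℕ} (B : Tensor K q) (i : Fin K → Fin d) {T : Type*}
    [MeasurableSpace T] (A : T → Fin K → Matrix (Fin d) (Fin q) ℝ)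
    (hA : ∀ k a c, Measurable fun z => A z k a c) :
    Measurable fun z => multiProd B (A z) i := by
  unfold multiProd
  exact Finset.measurable_sum _ fun j _ =>
    (Finset.measurable_prod _ fun k _ => hA k _ _).const_mul _

/-- The conditional distribution of the response tensor given the features, as a kernel. -/
def modelKernel (h : IsExpFamily ν b φ) (B : Tensor K p) :
    Kernel (Fin K → Fin d → Fin p → ℝ) (Tensor K d) where
  toFun z := Measure.pi fun i => expFamLaw ν b φ (multiProd B z i)
  measurable' := by
    have hprob (θ : ℝ) : IsProbabilityMeasure (expFamLaw ν b φ θ) := h.2 θ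
    have hpi (z : Fin K → Fin d → Fin p → ℝ) : IsProbabilityMeasure
        (Measure.pi fun i : Fin K → Fin d => expFamLaw ν b φ (multiProd B z i)) := inferInstance
    -- It suffices to test on boxes, where the product measure is a finite product of measurable
    -- functions of the features.
    refine Measurable.measure_of_isPiSystem_of_isProbabilityMeasure generateFrom_pi.symm
      isPiSystem_pi ?_
    rintro _ ⟨s, hs, rfl⟩
    simp only [Measure.pi_pi]
    exact Finset.measurable_prod _ fun i _ =>
      (h.measurable_expFamLaw_apply (hs i (Set.mem_univ i))).comp
        (measurable_multiProd B i _ fun k a c => by fun_prop)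

/-- A bound valid for every fixed value of the features integrates to the same bound, even for
events involving features and responses jointly. -/
lemma TensorModel.measure_le (h : IsExpFamily ν b φ) {B : Tensor K p} {Ω : Type*}
    [MeasurableSpace Ω] {P : Measure Ω} [IsProbabilityMeasure P]
    {Z : Ω → Fin K → Matrix (Fin d) (Fin p) ℝ} {Y : Ω → Tensor K d}
    (hm : TensorModel ν b φ B P Z Y) {T : Set ((Fin K → Fin d → Fin p → ℝ) × Tensor K d)}
    (hT : MeasurableSet T) {δ : ℝ≥0∞}
    (hδ : ∀ z : Fin K → Fin d → Fin p → ℝ,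
      Measure.pi (fun i => expFamLaw ν b φ (multiProd B z i)) {y | (z, y) ∈ T} ≤ δ) :
    P {ω | ((fun k i j => Z ω k i j : Fin K → Fin d → Fin p → ℝ), Y ω) ∈ T} ≤ δ := by
  have hprob (θ : ℝ) : IsProbabilityMeasure (expFamLaw ν b φ θ) := h.2 θ
  let Z' : Ω → Fin K → Fin d → Fin p → ℝ := fun ω k i j => Z ω k i j
  have hZ : Measurable Z' := by
    refine measurable_pi_lambda _ fun k => measurable_pi_lambda _ fun i =>
      measurable_pi_lambda _ fun j => hm.1 k i j
  have hY := hm.2.1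
  let κ := modelKernel (d := d) h B
  have hκ : IsMarkovKernel κ := ⟨fun z => by
    change IsProbabilityMeasure (Measure.pi fun i => expFamLaw ν b φ (multiProd B z i))
    infer_instance⟩
  have hprobZ : IsProbabilityMeasure (P.map Z') := Measure.isProbabilityMeasure_map hZ.aemeasurable
  -- The model specifies probabilities of rectangles only; these determine the joint law.
  have heq : P.map (fun ω => (Z' ω, Y ω)) = (P.map Z') ⊗ₘ κ := by
    have : IsProbabilityMeasure (P.map fun ω => (Z' ω, Y ω)) :=
      Measure.isProbabilityMeasure_map (hZ.prodMk hY).aemeasurable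
    refine Measure.ext_prod fun {A S} hA hS => ?_
    rw [Measure.map_apply (hZ.prodMk hY) (hA.prod hS), Measure.compProd_apply_prod hA hS,
      setLIntegral_map hA (κ.measurable_coe hS) hZ]
    exact hm.2.2 A S hA hS
  calc P {ω | (Z' ω, Y ω) ∈ T} = P.map (fun ω => (Z' ω, Y ω)) T :=
        (Measure.map_apply (hZ.prodMk hY) hT).symm
    _ = ∫⁻ z, κ z (Prod.mk z ⁻¹' T) ∂P.map Z' := by rw [heq, Measure.compProd_apply hT]
    _ ≤ ∫⁻ _, δ ∂P.map Z' := lintegral_mono fun z => hδ z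
    _ = δ := by simp

end Model

/-! ### Deterministic error bounds for the MLE -/

/-- All feature matrices have their squared singular values between `a₁` and `a₂`. -/
def DesignBounds {K d p : ℕ} (a₁ a₂ : ℝ) (z : Fin K → Matrix (Fin d) (Fin p) ℝ) : Prop :=
  ∀ k x, a₁ * ∑ j, x j ^ 2 ≤ ∑ i, (z k).mulVec x i ^ 2 ∧
    ∑ i, (z k).mulVec x i ^ 2 ≤ a₂ * ∑ j, x j ^ 2

/-- The residual `Y - E[Y]` at the parameter `w`. -/
def residual {K d p r : ℕ} (b : ℝ → ℝ) (z : Fin K → Matrix (Fin d) (Fin p) ℝ)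
    (w : Params K p r) (y : Tensor K d) : Tensor K d :=
  fun i => y i - deriv b (multiProd w.coef z i)

/-- The basic inequality for a maximizer of the likelihood. -/
lemma IsMLE.frobSq_predictor_le {K d p r : ℕ} {b : ℝ → ℝ} {α : ℝ≥0∞} {L U : ℝ}
    (hb : ContDiff ℝ 2 b) (hc : CurvatureBounds b α L U)
    {z : Fin K → Matrix (Fin d) (Fin p) ℝ} {y : Tensor K d} {w₀ w : Params K p r}
    (h0 : Feasible α z w₀) (hw : IsMLE b α z y w) :
    L / 2 * frobSq (multiProd (w.coef - w₀.coef) z) ≤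
      ∑ i, residual b z w₀ y i * multiProd (w.coef - w₀.coef) z i := by
  have h1 := hw.2 w₀ h0
  simp only [logLik] at h1
  rw [multiProd_sub, frobSq, Finset.mul_sum]
  calc _ ≤ ∑ i, (b (multiProd w.coef z i) - b (multiProd w₀.coef z i) -
        deriv b (multiProd w₀.coef z i) * (multiProd w.coef z i - multiProd w₀.coef z i)) :=
        Finset.sum_le_sum fun i _ => hc.le_sub hb (h0.2 i) (hw.1.2 i)
    _ ≤ _ := by
        simp only [residual, Pi.sub_apply, mul_sub, sub_mul, Finset.sum_sub_distrib]
        linarith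

/-- The difference of two Tucker decompositions of rank `r` is a Tucker decomposition of rank
`r + r` with contractive factors and a core that is no larger. -/
lemma exists_tucker_sub {K p r : ℕ} (w w' : Params K p r) :
    ∃ (G : Tensor K (r + r)) (N : Fin K → Matrix (Fin p) (Fin (r + r)) ℝ),
      (∀ k x, ∑ j, (N k).transpose.mulVec x j ^ 2 ≤ ∑ i, x i ^ 2) ∧
      w.coef - w'.coef = multiProd G N ∧ frobSq G ≤ frobSq (w.coef - w'.coef) := by
  choose N h1 h2 h3 using fun k =>
    exists_contraction_mul_transpose_fix (w.factor k) (w'.factor k)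
  refine ⟨multiProd (w.coef - w'.coef) fun k => (N k).transpose, N, h3, ?_, ?_⟩
  · rw [multiProd_multiProd, multiProd_sub, Params.coef, Params.coef, multiProd_multiProd,
      multiProd_multiProd]
    simp only [h1, h2]
  · simpa using frobSq_multiProd_le (w.coef - w'.coef) (fun k => (N k).transpose) zero_le_one
      fun k x => by simpa using h3 k x

/-- The basic inequality becomes `L/2 a₁^K ‖Δ‖² ≤ τ ‖Δ‖`; cancel one factor `‖Δ‖`. -/
lemma IsMLE.frobSq_coef_sub_le {K d p r : ℕ} {b : ℝ → ℝ} {α : ℝ≥0∞} {L U : ℝ} (hL : 0 < L)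
    (hb : ContDiff ℝ 2 b) (hc : CurvatureBounds b α L U) {a₁ a₂ : ℝ} (ha : 0 < a₁)
    {z : Fin K → Matrix (Fin d) (Fin p) ℝ} (hz : DesignBounds a₁ a₂ z) {y : Tensor K d}
    {w₀ w : Params K p r} (h0 : Feasible α z w₀) (hw : IsMLE b α z y w) {τ : ℝ}
    (hτ : ∀ (G : Tensor K (r + r)) (N : Fin K → Matrix (Fin p) (Fin (r + r)) ℝ),
      (∀ k x, ∑ j, (N k).transpose.mulVec x j ^ 2 ≤ ∑ i, x i ^ 2) →
      |∑ i, residual b z w₀ y i * multiProd G (fun k => z k * N k) i| ≤ τ * √(frobSq G)) :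
    frobSq (w₀.coef - w.coef) ≤ (2 * τ / (L * a₁ ^ K)) ^ 2 := by
  obtain ⟨G, N, hN, hGN, hG⟩ := exists_tucker_sub w w₀
  have hsymm : frobSq (w₀.coef - w.coef) = frobSq (w.coef - w₀.coef) :=
    Finset.sum_congr rfl fun i _ => by simp only [Pi.sub_apply]; ring
  have h1 := hw.frobSq_predictor_le hb hc h0
  have h2 := le_frobSq_multiProd (w.coef - w₀.coef) z ha.le fun k x => (hz k x).1
  have h3 := (le_abs_self _).trans (hτ G N hN)
  rw [← multiProd_multiProd, ← hGN] at h3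
  rw [hsymm]
  set D := frobSq (w.coef - w₀.coef)
  have hD : 0 ≤ D := frobSq_nonneg _
  rcases hD.eq_or_lt with h | hpos
  · rw [← h]; positivity
  have hs : 0 < √D := Real.sqrt_pos.2 hpos
  -- The sign of `τ` is needed to replace `√(frobSq G)` by the larger `√D`.
  have hτ0 : 0 ≤ τ := by
    by_contra! hneg
    have h4 : L / 2 * (a₁ ^ K * D) ≤ τ * √(frobSq G) :=
      (mul_le_mul_of_nonneg_left h2 (by positivity)).trans (h1.trans h3)
    have h5 : 0 < L / 2 * (a₁ ^ K * D) := by positivity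
    have h6 : τ * √(frobSq G) ≤ 0 := mul_nonpos_of_nonpos_of_nonneg hneg.le (Real.sqrt_nonneg _)
    linarith
  have h4 : L / 2 * (a₁ ^ K * D) ≤ τ * √D :=
    (mul_le_mul_of_nonneg_left h2 (by positivity)).trans
      (h1.trans (h3.trans (by gcongr)))
  have h5 : √D ≤ 2 * τ / (L * a₁ ^ K) := by
    rw [le_div_iff₀ (by positivity)]
    have h6 : L / 2 * (a₁ ^ K * √D) * √D ≤ τ * √D := by
      calc _ = L / 2 * (a₁ ^ K * (√D * √D)) := by ring
        _ = L / 2 * (a₁ ^ K * D) := by rw [Real.mul_self_sqrt hD]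
        _ ≤ _ := h4
    have h7 := le_of_mul_le_mul_right h6 hs
    linarith
  calc D = √D ^ 2 := (Real.sq_sqrt hD).symm
    _ ≤ _ := by gcongr

lemma errorBounds_of_frobSq_le {K p r d : ℕ} (hr : 1 ≤ r) {φ C : ℝ} {w₀ w : Params K p r}
    (h : frobSq (w₀.coef - w.coef) ≤ C * (φ * ((r : ℝ) ^ K + K * p * r) / (d : ℝ) ^ K)) :
    ErrorBounds d φ C w₀ w := by
  refine ⟨h, fun hs k => ?_⟩
  have h1 := (sinTheta_sq_mul_signal_sq_le hr w₀ w hs k).trans h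
  rw [← le_div_iff₀ (by positivity)] at h1
  refine h1.trans_eq ?_
  rw [mul_div_assoc, div_div, mul_comm ((d : ℝ) ^ K)]

/-! ### The union bound over the net -/

/-- The constant of the error bounds for a design with singular values between `c₁ √d` and
`c₂ √d`. -/
def rateConst (K : ℕ) (L U c₁ c₂ : ℝ) : ℝ :=
  (2 * 2 ^ (K + 1) / L) ^ 2 * (2 * U * 2 ^ (K + 2)) * (c₂ ^ 2) ^ K / ((c₁ ^ 2) ^ K) ^ 2

lemma rateConst_pos (K : ℕ) {L U c₁ c₂ : ℝ} (hL : 0 < L) (hU : 0 < U) (h₁ : 0 < c₁)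
    (h₂ : 0 < c₂) : 0 < rateConst K L U c₁ c₂ := by
  unfold rateConst; positivity

/-- With `5 ≤ e²`, `2 ≤ e` and net exponent at most `2^K R`, the total exponent is at most `1 -
2^(K+1) R`. This is below `-2p`, as `R ≥ p ≥ 1`. -/
lemma two_mul_five_pow_mul_exp_le {K p r : ℕ} (hK : 1 ≤ K) (hr : 1 ≤ r) (hp : 1 ≤ p) :
    (5 : ℝ) ^ ((r + r) ^ K + K * (p * (r + r))) *
      (2 * Real.exp (-(2 ^ (K + 2) * ((r : ℝ) ^ K + K * p * r)))) ≤ Real.exp (-(2 * p : ℝ)) := by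
  set R : ℝ := (r : ℝ) ^ K + K * p * r with hR
  have hK' : (1 : ℝ) ≤ K := by exact_mod_cast hK
  have hr' : (1 : ℝ) ≤ r := by exact_mod_cast hr
  have hp' : (1 : ℝ) ≤ p := by exact_mod_cast hp
  have h2K : (2 : ℝ) ≤ 2 ^ K := by
    calc (2 : ℝ) = 2 ^ 1 := by norm_num
      _ ≤ 2 ^ K := pow_le_pow_right₀ (by norm_num) hK
  have hKpr : (p : ℝ) ≤ K * p * r := by
    calc (p : ℝ) = 1 * p * 1 := by ring
      _ ≤ K * p * r := by gcongr
  have hpR : (p : ℝ) ≤ R := by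
    have : 0 ≤ (r : ℝ) ^ K := by positivity
    linarith
  have hm : (((r + r) ^ K + K * (p * (r + r)) : ℕ) : ℝ) ≤ 2 ^ K * R := by
    push_cast
    rw [← two_mul, mul_pow, hR, mul_add]
    have := mul_le_mul_of_nonneg_right h2K (by positivity : (0 : ℝ) ≤ K * p * r)
    linarith
  have h5 : (5 : ℝ) ≤ Real.exp 2 := by
    have h1 : (2.7182818283 : ℝ) < Real.exp 1 := Real.exp_one_gt_d9
    have h2 : Real.exp 2 = Real.exp 1 * Real.exp 1 := by rw [← Real.exp_add]; norm_num
    rw [h2]; nlinarith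
  have h2e : (2 : ℝ) ≤ Real.exp 1 := by
    have h1 : (2.7182818283 : ℝ) < Real.exp 1 := Real.exp_one_gt_d9
    linarith
  set m := (r + r) ^ K + K * (p * (r + r))
  calc (5 : ℝ) ^ m * (2 * Real.exp (-(2 ^ (K + 2) * R)))
      ≤ Real.exp 2 ^ m * (Real.exp 1 * Real.exp (-(2 ^ (K + 2) * R))) := by gcongr
    _ = Real.exp (m * 2 + (1 + -(2 ^ (K + 2) * R))) := by
        rw [Real.exp_add, Real.exp_add, Real.exp_nat_mul]
    _ ≤ Real.exp (-(2 * p : ℝ)) := by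
        rw [Real.exp_le_exp, pow_add]
        have := mul_le_mul_of_nonneg_right h2K (by linarith : 0 ≤ R)
        linarith

/-- Under design bounds, the error bounds hold with conditional probability
at least `1 - exp (-2p)`. -/
lemma measure_design_and_not_errorBounds_le {K : ℕ} (hK : 1 ≤ K) {L U : ℝ} (hL : 0 < L)
    (hU : 0 < U) {c₁ c₂ : ℝ} (hc₁ : 0 < c₁) (hc₂ : 0 < c₂) {p d r : ℕ} (hr : 1 ≤ r) (hp : 1 ≤ p)
    (hd : 1 ≤ d) {ν : Measure ℝ} {b : ℝ → ℝ} {φ : ℝ} (hexp : IsExpFamily ν b φ) {α : ℝ≥0∞}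
    (hcurv : CurvatureBounds b α L U) {Ω : Type*} [MeasurableSpace Ω] {P : Measure Ω}
    [IsProbabilityMeasure P] {Z : Ω → Fin K → Matrix (Fin d) (Fin p) ℝ} {Y : Ω → Tensor K d}
    {w₀ : Params K p r} (hm : TensorModel ν b φ w₀.coef P Z Y) :
    P {ω | DesignBounds (c₁ ^ 2 * d) (c₂ ^ 2 * d) (Z ω) ∧
      ¬ (Feasible α (Z ω) w₀ → ∀ w : Params K p r, IsMLE b α (Z ω) (Y ω) w →
        ErrorBounds d φ (rateConst K L U c₁ c₂) w₀ w)} ≤ ENNReal.ofReal (Real.exp (-(2 * p : ℝ))) := by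
  classical
  obtain ⟨S, hScard, hS, hSnet⟩ := exists_tucker_net K p (r + r)
  have hφ := hexp.1
  have hb := hexp.contDiff
  have hd' : (0 : ℝ) < d := by exact_mod_cast hd
  have hr' : (0 : ℝ) < r := by exact_mod_cast hr
  set R : ℝ := (r : ℝ) ^ K + K * p * r with hR
  have hRpos : 0 < R := by positivity
  set V : ℝ := (c₂ ^ 2 * d) ^ K with hV
  -- Chosen so that the sub-Gaussian exponent `t² / (2UφV)` is `2^(K+2) R`, which dominates the
  -- logarithm of the net size.
  set t : ℝ := √(2 * (U * φ * V) * (2 ^ (K + 2) * R)) with ht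
  have htsq : t ^ 2 = 2 * (U * φ * V) * (2 ^ (K + 2) * R) := Real.sq_sqrt (by positivity)
  let A (z : Fin K → Matrix (Fin d) (Fin p) ℝ)
      (s : Tensor K (r + r) × (Fin K → Matrix (Fin p) (Fin (r + r)) ℝ)) : Tensor K d :=
    multiProd s.1 fun k => z k * s.2 k
  -- The truncation `frobSq ≤ V` is part of the event, so its tail bound holds for every value of
  -- the features. Under the design bounds it is automatic.
  let T (s : Tensor K (r + r) × (Fin K → Matrix (Fin p) (Fin (r + r)) ℝ)) :
      Set ((Fin K → Fin d → Fin p → ℝ) × Tensor K d) :=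
    {x | frobSq (A x.1 s) ≤ V ∧ t < |∑ i, residual b x.1 w₀ x.2 i * A x.1 s i|}
  have hAmeas (s) (i) :
      Measurable fun x : (Fin K → Fin d → Fin p → ℝ) × Tensor K d => A x.1 s i := by
    refine measurable_multiProd s.1 i
      (fun x : (Fin K → Fin d → Fin p → ℝ) × Tensor K d =>
        (fun z : Fin K → Matrix (Fin d) (Fin p) ℝ => fun k => z k * s.2 k) x.1) fun k a c => ?_
    change Measurable fun x : (Fin K → Fin d → Fin p → ℝ) × Tensor K d =>
      ∑ e, x.1 k a e * s.2 k e c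
    fun_prop
  have hTmeas (s) : MeasurableSet (T s) := by
    have hres (i) : Measurable fun x : (Fin K → Fin d → Fin p → ℝ) × Tensor K d =>
        residual b x.1 w₀ x.2 i := by
      refine Measurable.sub (by fun_prop) ((measurable_deriv b).comp ?_)
      exact measurable_multiProd w₀.coef i _ fun k a c => by fun_prop
    have h1 : Measurable fun x : (Fin K → Fin d → Fin p → ℝ) × Tensor K d =>
        frobSq (A x.1 s) := Finset.measurable_sum _ fun i _ => (hAmeas s i).pow_const 2
    have h2 : Measurable fun x : (Fin K → Fin d → Fin p → ℝ) × Tensor K d =>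
        |∑ i, residual b x.1 w₀ x.2 i * A x.1 s i| :=
      continuous_abs.measurable.comp
        (Finset.measurable_sum _ fun i _ => (hres i).mul (hAmeas s i))
    exact (measurableSet_le h1 measurable_const).inter (measurableSet_lt measurable_const h2)
  have hTle (s) : P {ω | ((fun k i j => Z ω k i j : Fin K → Fin d → Fin p → ℝ), Y ω) ∈ T s} ≤
      ENNReal.ofReal (2 * Real.exp (-(2 ^ (K + 2) * R))) := by
    refine hm.measure_le hexp (hTmeas s) fun z => ?_
    by_cases hz : frobSq (A z s) ≤ V
    · have h1 := hexp.measure_pi_abs_sum_gt_le hcurv hU.le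
        (fun i => multiProd w₀.coef z i) (A z s) hz (Real.sqrt_nonneg _ : 0 ≤ t)
      rw [neg_div, htsq, mul_div_cancel_left₀ _ (by positivity)] at h1
      exact (measure_mono fun y hy => hy.2).trans h1
    · have : {y | (z, y) ∈ T s} = ∅ := Set.eq_empty_of_forall_notMem fun y hy => hz hy.1
      rw [this]; simp
  have hsub : {ω | DesignBounds (c₁ ^ 2 * d) (c₂ ^ 2 * d) (Z ω) ∧
      ¬ (Feasible α (Z ω) w₀ → ∀ w : Params K p r, IsMLE b α (Z ω) (Y ω) w →
        ErrorBounds d φ (rateConst K L U c₁ c₂) w₀ w)} ⊆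
      ⋃ s ∈ S, {ω | ((fun k i j => Z ω k i j : Fin K → Fin d → Fin p → ℝ), Y ω) ∈ T s} := by
    rintro ω ⟨hdes, hbad⟩
    by_contra hω
    simp only [Set.mem_iUnion, not_exists] at hω
    refine hbad fun hfeas w hw => errorBounds_of_frobSq_le hr ?_
    have hnet := hSnet d (Z ω) (residual b (Z ω) w₀ (Y ω)) t fun s hs => by
      by_contra! hlt
      refine hω s hs ⟨?_, hlt⟩
      have h1 := frobSq_multiProd_le s.1 (fun k => Z ω k * s.2 k) (c := c₂ ^ 2 * d)
        (by positivity) fun k x => by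
          rw [← Matrix.mulVec_mulVec]
          exact (hdes k _).2.trans (mul_le_mul_of_nonneg_left ((hS s hs).2 k x) (by positivity))
      exact h1.trans (mul_le_of_le_one_right (by positivity) (hS s hs).1)
    refine (hw.frobSq_coef_sub_le hL hb hcurv (a₁ := c₁ ^ 2 * d) (by positivity) hdes hfeas
      hnet).trans_eq ?_
    -- `V` contributes `d^K` and the denominator `d^(2K)`, which leaves `d^(-K)`.
    rw [div_pow, mul_pow, mul_pow, mul_pow, htsq, hV, rateConst]
    field_simp
    ring
  calc _ ≤ ∑ s ∈ S, P {ω | ((fun k i j => Z ω k i j : Fin K → Fin d → Fin p → ℝ), Y ω) ∈ T s} :=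
        (measure_mono hsub).trans (measure_biUnion_finset_le _ _)
    _ ≤ ∑ s ∈ S, ENNReal.ofReal (2 * Real.exp (-(2 ^ (K + 2) * R))) :=
        Finset.sum_le_sum fun s _ => hTle s
    _ = ENNReal.ofReal (S.card * (2 * Real.exp (-(2 ^ (K + 2) * R)))) := by
        rw [Finset.sum_const, nsmul_eq_mul, ENNReal.ofReal_mul (p := (S.card : ℝ)) (by positivity),
          ENNReal.ofReal_natCast]
    _ ≤ _ := by
        refine ENNReal.ofReal_le_ofReal (le_trans ?_ (two_mul_five_pow_mul_exp_le hK hr hp))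
        gcongr
        exact_mod_cast hScard

/-! ### Chi-square tails -/

section ChiSquare

lemma gaussianPDFReal_mul_exp_sq (t x : ℝ) :
    gaussianPDFReal 0 1 x * Real.exp (t * x ^ 2) =
      (√(2 * Real.pi))⁻¹ * Real.exp (-(1 / 2 - t) * x ^ 2) := by
  rw [gaussianPDFReal, mul_assoc, ← Real.exp_add]
  simp only [NNReal.coe_one, mul_one, sub_zero]
  congr 2
  ring

lemma integrable_exp_mul_sq_gaussianReal {t : ℝ} (ht : t < 1 / 2) :
    Integrable (fun x => Real.exp (t * x ^ 2)) (gaussianReal 0 1) := by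
  rw [gaussianReal_of_var_ne_zero _ one_ne_zero, integrable_withDensity_iff_integrable_smul₀'
    (measurable_gaussianPDF _ _).aemeasurable (ae_of_all _ fun _ => gaussianPDF_lt_top)]
  simp only [toReal_gaussianPDF, smul_eq_mul, gaussianPDFReal_mul_exp_sq]
  exact (integrable_exp_neg_mul_sq (by linarith)).const_mul _

lemma mgf_sq_gaussianReal {t : ℝ} (ht : t < 1 / 2) :
    mgf (fun x => x ^ 2) (gaussianReal 0 1) t = √(1 / (1 - 2 * t)) := by
  rw [mgf, integral_gaussianReal_eq_integral_smul one_ne_zero]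
  simp only [smul_eq_mul, gaussianPDFReal_mul_exp_sq]
  rw [integral_const_mul, integral_gaussian, ← Real.sqrt_inv, ← Real.sqrt_mul (by positivity)]
  congr 1
  have h1 : 1 - 2 * t ≠ 0 := by linarith
  have h2 : 1 / 2 - t ≠ 0 := by linarith
  have := Real.pi_pos.ne'
  field_simp

variable {d : ℕ}

lemma iIndepFun_sq_pi_gaussianReal :
    iIndepFun (fun i (x : Fin d → ℝ) => x i ^ 2) (Measure.pi fun _ => gaussianReal 0 1) :=
  iIndepFun_pi (X := fun _ (x : ℝ) => x ^ 2) fun _ => by fun_prop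

lemma integrable_exp_mul_sum_sq_pi_gaussianReal {t : ℝ} (ht : t < 1 / 2) :
    Integrable (fun x : Fin d → ℝ => Real.exp (t * ∑ i, x i ^ 2))
      (Measure.pi fun _ => gaussianReal 0 1) := by
  have h := iIndepFun_sq_pi_gaussianReal (d := d).integrable_exp_mul_sum (t := t)
    (s := Finset.univ) (fun i => by fun_prop) fun i _ => ?_
  · simpa only [Finset.sum_apply] using h
  · exact (measurePreserving_eval (fun _ : Fin d => gaussianReal 0 1) i).integrable_comp_of_integrable
      (integrable_exp_mul_sq_gaussianReal ht)

lemma mgf_sum_sq_pi_gaussianReal {t : ℝ} (ht : t < 1 / 2) :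
    mgf (fun x : Fin d → ℝ => ∑ i, x i ^ 2) (Measure.pi fun _ => gaussianReal 0 1) t =
      √(1 / (1 - 2 * t)) ^ d := by
  have h := iIndepFun_sq_pi_gaussianReal (d := d).mgf_sum (t := t) (fun i => by fun_prop)
    Finset.univ
  have h1 : (fun x : Fin d → ℝ => ∑ i, x i ^ 2) = ∑ i, fun x : Fin d → ℝ => x i ^ 2 := by
    ext x; simp
  rw [h1, h, Finset.prod_congr rfl fun i _ => ?_, Finset.prod_const, Finset.card_univ,
    Fintype.card_fin]
  have hi : AEMeasurable (fun x : Fin d → ℝ => x i) (Measure.pi fun _ => gaussianReal 0 1) :=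
    (measurable_pi_apply i).aemeasurable
  have h2 := mgf_map (X := fun x : ℝ => x ^ 2) (t := t) hi (by fun_prop)
  rw [show (Measure.pi fun _ : Fin d => gaussianReal 0 1).map (fun x => x i) = gaussianReal 0 1
    from (measurePreserving_eval (fun _ : Fin d => gaussianReal 0 1) i).map_eq,
    mgf_sq_gaussianReal ht] at h2
  exact h2.symm

/-- Small-ball estimate for the chi-square distribution. -/
lemma measure_sum_sq_le_le {η : ℝ} (hη : 0 < η) :
    (Measure.pi fun _ : Fin d => gaussianReal 0 1).real {x | ∑ i, x i ^ 2 ≤ η ^ 2 * d} ≤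
      (Real.exp 1 * η) ^ d := by
  -- Chernoff with `t = -1/η²`: the exponential prefactor is `e^d`, and each coordinate contributes
  -- `(1 + 2/η²)^(-1/2) ≤ η`.
  have ht : -(η ^ 2)⁻¹ < 1 / 2 := by
    have : 0 < (η ^ 2)⁻¹ := by positivity
    linarith
  refine (measure_le_le_exp_mul_mgf (t := -(η ^ 2)⁻¹) _ (by simp; positivity)
    (integrable_exp_mul_sum_sq_pi_gaussianReal ht)).trans ?_
  rw [mgf_sum_sq_pi_gaussianReal ht, mul_pow, ← Real.exp_nat_mul, mul_one, neg_neg,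
    inv_mul_cancel_left₀ (by positivity)]
  gcongr
  rw [Real.sqrt_le_left hη.le, div_le_iff₀ (by linarith)]
  have : η ^ 2 * (1 - 2 * -(η ^ 2)⁻¹) = η ^ 2 + 2 := by field_simp; ring
  rw [this]
  nlinarith [sq_nonneg η]

/-- Upper tail estimate for the chi-square distribution. -/
lemma measure_le_sum_sq_le (M : ℝ) :
    (Measure.pi fun _ : Fin d => gaussianReal 0 1).real {x | M ^ 2 * d ≤ ∑ i, x i ^ 2} ≤
      (2 * Real.exp (-M ^ 2 / 4)) ^ d := by
  have ht : (1 / 4 : ℝ) < 1 / 2 := by norm_num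
  refine (measure_ge_le_exp_mul_mgf (t := 1 / 4) _ (by norm_num)
    (integrable_exp_mul_sum_sq_pi_gaussianReal ht)).trans ?_
  rw [mgf_sum_sq_pi_gaussianReal ht, mul_pow, ← Real.exp_nat_mul, mul_comm (2 ^ d)]
  refine mul_le_mul (le_of_eq (by congr 1; ring)) ?_ (by positivity) (by positivity)
  gcongr
  rw [Real.sqrt_le_left (by norm_num)]
  norm_num

end ChiSquare

/-! ### Singular values of Gaussian matrices -/

section GaussianMatrix
variable {d p : ℕ} {Ω : Type*} [MeasurableSpace Ω] {P : Measure Ω} [IsProbabilityMeasure P]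

/-- A Gaussian matrix maps a fixed unit vector to a standard Gaussian vector. -/
lemma map_mulVec_eq_pi_gaussianReal {X : Ω → Matrix (Fin d) (Fin p) ℝ}
    (hlaw : ∀ i j, HasLaw (fun ω => X ω i j) (gaussianReal 0 1) P)
    (hind : iIndepFun (fun (e : Fin d × Fin p) ω => X ω e.1 e.2) P) {u : Fin p → ℝ}
    (hu : ∑ j, u j ^ 2 = 1) :
    P.map (fun ω => (X ω).mulVec u) = Measure.pi fun _ => gaussianReal 0 1 := by
  have hX : P.map (fun ω (e : Fin d × Fin p) => X ω e.1 e.2) =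
      Measure.pi fun _ => gaussianReal 0 1 := by
    have h := (iIndepFun_iff_map_fun_eq_pi_map (f := fun (e : Fin d × Fin p) ω => X ω e.1 e.2)
      fun e => (hlaw e.1 e.2).aemeasurable).1 hind
    refine h.trans ?_
    congr 1
    funext e
    exact (hlaw e.1 e.2).map_eq
  have hXm : AEMeasurable (fun ω (e : Fin d × Fin p) => X ω e.1 e.2) P :=
    aemeasurable_pi_lambda _ fun e => (hlaw e.1 e.2).aemeasurable
  let A : (Fin d × Fin p → ℝ) → Fin d → ℝ := fun x i => ∑ j, x (i, j) * u j
  have hA : Measurable A := by fun_prop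
  have h1 : P.map (fun ω => (X ω).mulVec u) =
      (Measure.pi fun _ : Fin d × Fin p => gaussianReal 0 1).map A := by
    rw [← hX, AEMeasurable.map_map_of_aemeasurable hA.aemeasurable hXm]
    rfl
  rw [h1]
  have hlp : (Measure.pi fun _ : Fin d × Fin p => gaussianReal 0 1).map (WithLp.toLp 2 ∘ A) =
      (Measure.pi fun _ : Fin d => gaussianReal 0 1).map (WithLp.toLp 2) := by
    have : IsProbabilityMeasure ((Measure.pi fun _ : Fin d × Fin p => gaussianReal 0 1).map
      (WithLp.toLp 2 ∘ A)) := Measure.isProbabilityMeasure_map (by fun_prop)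
    rw [map_pi_eq_stdGaussian]
    refine Measure.ext_of_charFun ?_
    ext t
    -- The adjoint of `A` sends `t` to `t ⊗ u`, of the same norm since `u` is a unit vector. A
    -- standard Gaussian characteristic function depends only on the norm.
    let s : EuclideanSpace ℝ (Fin d × Fin p) := WithLp.toLp 2 fun e => t.ofLp e.1 * u e.2
    have hs : ‖s‖ ^ 2 = ‖t‖ ^ 2 := by
      rw [EuclideanSpace.real_norm_sq_eq, EuclideanSpace.real_norm_sq_eq]
      simp only [s, Fintype.sum_prod_type, mul_pow, ← Finset.mul_sum, hu, mul_one]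
    have h2 : charFun ((Measure.pi fun _ : Fin d × Fin p => gaussianReal 0 1).map
        (WithLp.toLp 2 ∘ A)) t =
        charFun ((Measure.pi fun _ : Fin d × Fin p => gaussianReal 0 1).map (WithLp.toLp 2)) s := by
      rw [charFun_apply, charFun_apply, integral_map (by fun_prop) (by fun_prop),
        integral_map (by fun_prop) (by fun_prop)]
      congr 1
      funext x
      congr 3
      simp only [Function.comp, PiLp.inner_apply, A, s, Fintype.sum_prod_type]
      simp [Finset.mul_sum, mul_comm, mul_left_comm, mul_assoc]
    rw [h2, map_pi_eq_stdGaussian, charFun_stdGaussian, charFun_stdGaussian]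
    have hs' : ((‖s‖ : ℂ)) ^ 2 = (‖t‖ : ℂ) ^ 2 := by exact_mod_cast hs
    rw [hs']
  have h3 := congrArg (fun μ => Measure.map (WithLp.ofLp (p := 2)) μ) hlp
  simp only at h3
  rw [Measure.map_map (by fun_prop) (by fun_prop), Measure.map_map (by fun_prop) (by fun_prop)] at h3
  simpa [Function.comp_def] using h3

end GaussianMatrix

section OperatorNets
variable {E F : Type*} [NormedAddCommGroup E] [NormedSpace ℝ E] [NormedAddCommGroup F]
  [NormedSpace ℝ F]

/-- Absorption as for functionals, with a net of the sphere alone. That net may be empty in the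
trivial space, hence the separate hypothesis `0 ≤ t`. -/
lemma opNorm_le_two_mul_of_net (g : E →L[ℝ] F) {s : Finset E} {t : ℝ} (ht0 : 0 ≤ t)
    (hs : ∀ x : E, ‖x‖ = 1 → ∃ c ∈ s, ‖x - c‖ ≤ 1 / 2) (ht : ∀ c ∈ s, ‖g c‖ ≤ t) :
    ‖g‖ ≤ 2 * t := by
  have h1 : ‖g‖ ≤ t + ‖g‖ / 2 := by
    refine g.opNorm_le_of_unit_norm (by positivity) fun y hy => ?_
    obtain ⟨c, hc, hyc⟩ := hs y hy
    calc ‖g y‖ = ‖g c + g (y - c)‖ := by rw [← map_add]; simp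
      _ ≤ ‖g c‖ + ‖g (y - c)‖ := norm_add_le _ _
      _ ≤ t + ‖g‖ * (1 / 2) := add_le_add (ht c hc) ((g.le_opNorm _).trans (by gcongr))
      _ = _ := by ring
  linarith

lemma le_norm_of_net (g : E →L[ℝ] F) {s : Finset E} {t T δ : ℝ} (hT : ‖g‖ ≤ T)
    (hT0 : 0 ≤ T) (hs : ∀ x : E, ‖x‖ = 1 → ∃ c ∈ s, ‖x - c‖ ≤ δ) (ht : ∀ c ∈ s, t ≤ ‖g c‖) (x : E) :
    (t - T * δ) * ‖x‖ ≤ ‖g x‖ := by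
  by_cases hx : x = 0
  · simp [hx]
  have hpos : 0 < ‖x‖ := norm_pos_iff.2 hx
  obtain ⟨c, hc, hxc⟩ := hs (‖x‖⁻¹ • x) (by rw [norm_smul]; simp [hx])
  have h1 : t - T * δ ≤ ‖g (‖x‖⁻¹ • x)‖ := by
    have h2 : ‖g c‖ ≤ ‖g (‖x‖⁻¹ • x)‖ + ‖g (‖x‖⁻¹ • x - c)‖ := by
      calc ‖g c‖ = ‖g (‖x‖⁻¹ • x) - g (‖x‖⁻¹ • x - c)‖ := by rw [← map_sub]; simp
        _ ≤ _ := norm_sub_le _ _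
    have h3 : ‖g (‖x‖⁻¹ • x - c)‖ ≤ T * δ := (g.le_opNorm _).trans (by gcongr)
    have h4 := ht c hc
    linarith
  rw [map_smul, norm_smul, norm_inv, norm_norm, ← div_eq_inv_mul, le_div_iff₀ hpos] at h1
  exact h1

end OperatorNets

section GaussianMatrix
variable {d p : ℕ} {Ω : Type*} [MeasurableSpace Ω] {P : Measure Ω} [IsProbabilityMeasure P]

lemma measure_mulVec_preimage_eq {X : Ω → Matrix (Fin d) (Fin p) ℝ}
    (hlaw : ∀ i j, HasLaw (fun ω => X ω i j) (gaussianReal 0 1) P)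
    (hind : iIndepFun (fun (e : Fin d × Fin p) ω => X ω e.1 e.2) P)
    {u : EuclideanSpace ℝ (Fin p)} (hu : ‖u‖ = 1) {S : Set (Fin d → ℝ)} (hS : MeasurableSet S) :
    P {ω | (X ω).mulVec u.ofLp ∈ S} =
      ENNReal.ofReal ((Measure.pi fun _ : Fin d => gaussianReal 0 1).real S) := by
  have hu2 : ∑ j, u.ofLp j ^ 2 = 1 := by rw [← EuclideanSpace.real_norm_sq_eq, hu, one_pow]
  have hm : AEMeasurable (fun ω => (X ω).mulVec u.ofLp) P := by
    refine aemeasurable_pi_lambda _ fun i => ?_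
    simp only [Matrix.mulVec, dotProduct]
    exact Finset.aemeasurable_fun_sum _ fun j _ => (hlaw i j).aemeasurable.mul_const _
  rw [ofReal_measureReal, ← map_mulVec_eq_pi_gaussianReal hlaw hind hu2,
    Measure.map_apply_of_aemeasurable hm hS]
  rfl

/-- Two-sided bounds for the singular values of a Gaussian matrix. -/
lemma measure_not_singular_bounds_le {X : Ω → Matrix (Fin d) (Fin p) ℝ}
    (hlaw : ∀ i j, HasLaw (fun ω => X ω i j) (gaussianReal 0 1) P)
    (hind : iIndepFun (fun (e : Fin d × Fin p) ω => X ω e.1 e.2) P) {η M : ℝ} (hη : 0 < η)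
    (hM : 0 < M) :
    P {ω | ¬ ∀ x : Fin p → ℝ, η ^ 2 * d * ∑ j, x j ^ 2 ≤ ∑ i, (X ω).mulVec x i ^ 2 ∧
      ∑ i, (X ω).mulVec x i ^ 2 ≤ (2 * M) ^ 2 * d * ∑ j, x j ^ 2} ≤
      ENNReal.ofReal (5 ^ p * (2 * Real.exp (-M ^ 2 / 4)) ^ d +
        (1 + 4 * M / η) ^ p * (Real.exp 1 * (2 * η)) ^ d) := by
  obtain ⟨S₁, h1, h1c, h1n⟩ := exists_net (E := EuclideanSpace ℝ (Fin p)) (δ := 1 / 2)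
    (by norm_num) {x | ‖x‖ = 1} fun x hx => le_of_eq hx
  -- A finer net for the lower bound: with operator norm at most `2M√d`, spacing `η / (2M)` loses
  -- `η√d` out of `2η√d`.
  obtain ⟨S₂, h2, h2c, h2n⟩ := exists_net (E := EuclideanSpace ℝ (Fin p)) (δ := η / (2 * M))
    (by positivity) {x | ‖x‖ = 1} fun x hx => le_of_eq hx
  have hsq : Measurable fun x : Fin d → ℝ => ∑ i, x i ^ 2 := by fun_prop
  have hsub : {ω | ¬ ∀ x : Fin p → ℝ, η ^ 2 * d * ∑ j, x j ^ 2 ≤ ∑ i, (X ω).mulVec x i ^ 2 ∧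
      ∑ i, (X ω).mulVec x i ^ 2 ≤ (2 * M) ^ 2 * d * ∑ j, x j ^ 2} ⊆
      (⋃ c ∈ S₁, {ω | (X ω).mulVec c.ofLp ∈ {x : Fin d → ℝ | M ^ 2 * d ≤ ∑ i, x i ^ 2}}) ∪
      ⋃ c ∈ S₂, {ω | (X ω).mulVec c.ofLp ∈ {x : Fin d → ℝ | ∑ i, x i ^ 2 ≤ (2 * η) ^ 2 * d}} := by
    intro ω hω
    by_contra hgood
    simp only [Set.mem_union, Set.mem_iUnion, not_or, not_exists] at hgood
    obtain ⟨hg1, hg2⟩ := hgood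
    refine hω ?_
    let g := LinearMap.toContinuousLinearMap (Matrix.toEuclideanLin (X ω))
    have hg (x : EuclideanSpace ℝ (Fin p)) : ‖g x‖ ^ 2 = ∑ i, (X ω).mulVec x.ofLp i ^ 2 :=
      sq_norm_toEuclideanLin _ _
    have hup : ‖g‖ ≤ 2 * (M * √d) := by
      refine opNorm_le_two_mul_of_net g (by positivity) h1n fun c hc => ?_
      refine le_of_sq_le_sq ?_ (by positivity)
      rw [hg, mul_pow, Real.sq_sqrt (Nat.cast_nonneg d)]
      exact (not_le.1 (hg1 c hc)).le
    have hlow := le_norm_of_net g hup (by positivity) h2n (t := 2 * η * √d) fun c hc => by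
      refine le_of_sq_le_sq ?_ (norm_nonneg _)
      rw [hg, mul_pow, Real.sq_sqrt (Nat.cast_nonneg d)]
      exact (not_le.1 (hg2 c hc)).le
    have hsimp : 2 * η * √d - 2 * (M * √d) * (η / (2 * M)) = η * √d := by
      field_simp
      ring
    rw [hsimp] at hlow
    intro x
    have hl := pow_le_pow_left₀ (by positivity) (hlow (WithLp.toLp 2 x)) 2
    have hu := pow_le_pow_left₀ (norm_nonneg _) ((g.le_opNorm (WithLp.toLp 2 x)).trans
      (mul_le_mul_of_nonneg_right hup (norm_nonneg _))) 2
    rw [hg, mul_pow, mul_pow, Real.sq_sqrt (Nat.cast_nonneg d),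
      EuclideanSpace.real_norm_sq_eq] at hl
    rw [hg, ← mul_assoc 2, mul_pow, mul_pow, Real.sq_sqrt (Nat.cast_nonneg d),
      EuclideanSpace.real_norm_sq_eq] at hu
    exact ⟨hl, hu⟩
  have hfin : Module.finrank ℝ (EuclideanSpace ℝ (Fin p)) = p := by simp
  rw [hfin] at h1c h2c
  rw [ENNReal.ofReal_add (by positivity) (by positivity)]
  refine (measure_mono hsub).trans ((measure_union_le _ _).trans (add_le_add ?_ ?_))
  · refine (measure_biUnion_finset_le _ _).trans ((Finset.sum_le_sum
      (g := fun _ => ENNReal.ofReal ((2 * Real.exp (-M ^ 2 / 4)) ^ d)) fun c hc => ?_).trans ?_)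
    · rw [measure_mulVec_preimage_eq hlaw hind (h1 c hc) (measurableSet_le measurable_const hsq)]
      exact ENNReal.ofReal_le_ofReal (measure_le_sum_sq_le M)
    · rw [Finset.sum_const, nsmul_eq_mul, ← ENNReal.ofReal_natCast,
        ← ENNReal.ofReal_mul (by positivity)]
      refine ENNReal.ofReal_le_ofReal ?_
      gcongr
      norm_num at h1c
      exact h1c
  · refine (measure_biUnion_finset_le _ _).trans ((Finset.sum_le_sum
      (g := fun _ => ENNReal.ofReal ((Real.exp 1 * (2 * η)) ^ d)) fun c hc => ?_).trans ?_)
    · rw [measure_mulVec_preimage_eq hlaw hind (h2 c hc) (measurableSet_le hsq measurable_const)]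
      exact ENNReal.ofReal_le_ofReal (measure_sum_sq_le_le (by positivity))
    · rw [Finset.sum_const, nsmul_eq_mul, ← ENNReal.ofReal_natCast,
        ← ENNReal.ofReal_mul (by positivity)]
      refine ENNReal.ofReal_le_ofReal ?_
      gcongr
      refine h2c.trans_eq ?_
      congr 2
      field_simp
      norm_num

/-- For aspect ratios bounded away from one, the constants of the singular value bounds can be
chosen so that the failure probability is at most `2 q ^ d`. -/
lemma exists_singular_constants {ρ q : ℝ} (hρ0 : 0 < ρ) (hρ1 : ρ < 1) (hq0 : 0 < q)
    (hq1 : q < 1) :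
    ∃ η M : ℝ, 0 < η ∧ 0 < M ∧ ∀ p d : ℕ, (p : ℝ) ≤ ρ * d →
      (5 : ℝ) ^ p * (2 * Real.exp (-M ^ 2 / 4)) ^ d +
        (1 + 4 * M / η) ^ p * (Real.exp 1 * (2 * η)) ^ d ≤ 2 * q ^ d := by
  have hlog : 0 < Real.log (10 / q) := Real.log_pos (by rw [lt_div_iff₀ hq0]; linarith)
  -- This makes `exp (-M² / 4) = q / 10`, so that `5^p ≤ 5^d` is absorbed.
  set M := 2 * √(Real.log (10 / q)) with hM
  have hMpos : 0 < M := by positivity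
  -- The second term is at most `(D η^(1-ρ))^d`; since `ρ < 1`, a small `η` brings the base below
  -- `q`. The minimum with `M` gives `1 + 4M/η ≤ 5M/η`.
  set D := (5 * M) ^ ρ * (2 * Real.exp 1) with hD
  have hDpos : 0 < D := by positivity
  set η := min M ((q / D) ^ (1 / (1 - ρ))) with hη
  have hηpos : 0 < η := lt_min hMpos (by positivity)
  refine ⟨η, M, hηpos, hMpos, fun p d hpd => ?_⟩
  have hpd' : p ≤ d := by
    have : (p : ℝ) ≤ d := hpd.trans (mul_le_of_le_one_left (by positivity) hρ1.le)
    exact_mod_cast this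
  rw [two_mul (q ^ d)]
  refine add_le_add ?_ ?_
  · have h1 : Real.exp (-M ^ 2 / 4) = q / 10 := by
      rw [hM, mul_pow, Real.sq_sqrt hlog.le,
        show -(2 ^ 2 * Real.log (10 / q)) / 4 = -Real.log (10 / q) by ring, Real.exp_neg,
        Real.exp_log (by positivity), inv_div]
    calc (5 : ℝ) ^ p * (2 * Real.exp (-M ^ 2 / 4)) ^ d
        ≤ 5 ^ d * (2 * Real.exp (-M ^ 2 / 4)) ^ d := by
          gcongr
          norm_num
      _ = q ^ d := by rw [← mul_pow, h1]; congr 1; ring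
  · have h1 : 1 + 4 * M / η ≤ 5 * M / η := by
      have : 1 ≤ M / η := by rw [le_div_iff₀ hηpos, one_mul]; exact min_le_left _ _
      calc 1 + 4 * M / η ≤ M / η + 4 * M / η := by gcongr
        _ = _ := by ring
    have h2 : 1 ≤ 5 * M / η := by
      have : 0 ≤ 4 * M / η := by positivity
      linarith
    have h3 : η ^ (1 - ρ) ≤ q / D := by
      calc η ^ (1 - ρ) ≤ ((q / D) ^ (1 / (1 - ρ))) ^ (1 - ρ) :=
            Real.rpow_le_rpow hηpos.le (min_le_right _ _) (by linarith)
        _ = q / D := by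
            rw [← Real.rpow_mul (by positivity), one_div, inv_mul_cancel₀ (by linarith),
              Real.rpow_one]
    calc (1 + 4 * M / η) ^ p * (Real.exp 1 * (2 * η)) ^ d
        ≤ (5 * M / η) ^ p * (Real.exp 1 * (2 * η)) ^ d := by gcongr
      _ ≤ ((5 * M / η) ^ ρ) ^ d * (Real.exp 1 * (2 * η)) ^ d := by
          gcongr
          rw [← Real.rpow_natCast, ← Real.rpow_natCast, ← Real.rpow_mul (by positivity)]
          exact Real.rpow_le_rpow_of_exponent_le h2 hpd
      _ = (D * η ^ (1 - ρ)) ^ d := by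
          rw [← mul_pow, Real.div_rpow (by positivity) hηpos.le, Real.rpow_sub hηpos,
            Real.rpow_one, hD]
          congr 1
          ring
      _ ≤ q ^ d := by
          gcongr
          rwa [le_div_iff₀ hDpos, mul_comm] at h3

/-- Gaussian features have singular values of order `√d` with overwhelming probability. -/
lemma GaussianDesign.exists_designBounds {K : ℕ} (hK : 1 ≤ K) {ρ : ℝ} (hρ0 : 0 < ρ)
    (hρ1 : ρ < 1) :
    ∃ c₁ c₂ : ℝ, 0 < c₁ ∧ 0 < c₂ ∧ ∀ p d : ℕ, 1 ≤ p → (p : ℝ) ≤ ρ * d →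
      ∀ (Ω : Type*) [MeasurableSpace Ω] (P : Measure Ω) [IsProbabilityMeasure P]
        (X : Ω → Fin K → Matrix (Fin d) (Fin p) ℝ), GaussianDesign P X →
        P {ω | ¬ DesignBounds (c₁ ^ 2 * d) (c₂ ^ 2 * d) (X ω)} ≤
          ENNReal.ofReal (Real.exp (-(p : ℝ)) / 2) := by
  have hK' : (1 : ℝ) ≤ K := by exact_mod_cast hK
  have he : Real.exp (-1) < 1 := by rw [Real.exp_lt_one_iff]; norm_num
  -- The `4K` absorbs the union over the `K` modes and leaves half of `e^(-p)`.
  set q : ℝ := Real.exp (-1) / (4 * K) with hq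
  have hq0 : 0 < q := by positivity
  have hq1 : q < 1 := by
    rw [hq, div_lt_one (by positivity)]
    linarith
  obtain ⟨η, M, hη, hM, hηM⟩ := exists_singular_constants hρ0 hρ1 hq0 hq1
  refine ⟨η, 2 * M, hη, by positivity, fun p d hp hpd Ω _ P _ X hX => ?_⟩
  have hpd' : p ≤ d := by
    have : (p : ℝ) ≤ d := hpd.trans (mul_le_of_le_one_left (by positivity) hρ1.le)
    exact_mod_cast this
  have hsub : {ω | ¬ DesignBounds (η ^ 2 * d) ((2 * M) ^ 2 * d) (X ω)} ⊆
      ⋃ k, {ω | ¬ ∀ x : Fin p → ℝ, η ^ 2 * d * ∑ j, x j ^ 2 ≤ ∑ i, (X ω k).mulVec x i ^ 2 ∧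
        ∑ i, (X ω k).mulVec x i ^ 2 ≤ (2 * M) ^ 2 * d * ∑ j, x j ^ 2} := by
    intro ω hω
    by_contra h
    simp only [Set.mem_iUnion, not_exists] at h
    exact hω fun k x => not_not.1 (h k) x
  have hqd : 2 * K * q ^ d ≤ Real.exp (-(p : ℝ)) / 2 := by
    have h1 : (4 * K : ℝ) ≤ (4 * K) ^ d := le_self_pow₀ (by linarith) (by omega)
    calc 2 * K * q ^ d = 2 * K * (Real.exp (-1) ^ d / (4 * K) ^ d) := by rw [hq, div_pow]
      _ ≤ 2 * K * (Real.exp (-1) ^ d / (4 * K)) := by gcongr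
      _ = Real.exp (-1) ^ d / 2 := by field_simp; norm_num
      _ ≤ Real.exp (-1) ^ p / 2 := by
          gcongr 1
          exact pow_le_pow_of_le_one (Real.exp_pos _).le he.le hpd'
      _ = _ := by rw [← Real.exp_nat_mul]; congr 2; ring
  calc _ ≤ ∑ k : Fin K, P {ω | ¬ ∀ x : Fin p → ℝ,
          η ^ 2 * d * ∑ j, x j ^ 2 ≤ ∑ i, (X ω k).mulVec x i ^ 2 ∧
          ∑ i, (X ω k).mulVec x i ^ 2 ≤ (2 * M) ^ 2 * d * ∑ j, x j ^ 2} :=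
        (measure_mono hsub).trans (measure_iUnion_fintype_le _ _)
    _ ≤ ∑ k : Fin K, ENNReal.ofReal (2 * q ^ d) :=
        Finset.sum_le_sum fun k _ => (measure_not_singular_bounds_le (hX k).1 (hX k).2 hη hM).trans
          (ENNReal.ofReal_le_ofReal (hηM p d hpd))
    _ = ENNReal.ofReal (2 * K * q ^ d) := by
        rw [Finset.sum_const, Finset.card_univ, Fintype.card_fin, nsmul_eq_mul,
          ← ENNReal.ofReal_natCast, ← ENNReal.ofReal_mul (by positivity)]
        congr 1
        ring
    _ ≤ _ := ENNReal.ofReal_le_ofReal hqd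

end GaussianMatrix

lemma BoundedDesign.designBounds {d p K : ℕ} {Ω : Type*} [MeasurableSpace Ω] {P : Measure Ω} (hp : 1 ≤ p) {c₁ c₂ : ℝ} (hc₁ : 0 ≤ c₁)
    {X Z : Ω → Fin K → Matrix (Fin d) (Fin p) ℝ} (hX : BoundedDesign c₁ c₂ P X)
    (hZ : ∀ ω k, Z ω k = √d • X ω k) :
    ∀ᵐ ω ∂P, DesignBounds (c₁ ^ 2 * d) (c₂ ^ 2 * d) (Z ω) := by
  filter_upwards [hX] with ω hω k x
  have h1 := sq_mul_le_of_le_singVal hp hc₁ (hω k).1 x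
  have h2 := le_sq_mul_of_singVal_le (hω k).2 x
  have h3 : ∑ i, (Z ω k).mulVec x i ^ 2 = d * ∑ i, (X ω k).mulVec x i ^ 2 := by
    rw [hZ, Matrix.smul_mulVec, Finset.mul_sum]
    refine Finset.sum_congr rfl fun i _ => ?_
    rw [Pi.smul_apply, smul_eq_mul, mul_pow, Real.sq_sqrt (Nat.cast_nonneg d)]
  rw [h3, mul_comm (c₁ ^ 2), mul_comm (c₂ ^ 2), mul_assoc, mul_assoc]
  exact ⟨by gcongr, by gcongr⟩

end TensorGLM

end

theorem theorem1 (K : ℕ) (hK : 1 ≤ K) (L U : ℝ) (hL : 0 < L) (hU : 0 < U) :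
    (∀ c₁ c₂ : ℝ, 0 < c₁ → 0 < c₂ → ∃ C : ℝ, 0 < C ∧
      ∀ p d r : ℕ, 1 ≤ r → r ≤ p → p ≤ d →
      ∀ (ν : Measure ℝ) (b : ℝ → ℝ) (φ : ℝ), TensorGLM.IsExpFamily ν b φ →
      ∀ α : ℝ≥0∞, 0 < α → TensorGLM.CurvatureBounds b α L U →
      ∀ (Ω : Type*) [MeasurableSpace Ω] (P : Measure Ω) [IsProbabilityMeasure P]
        (X Z : Ω → Fin K → Matrix (Fin d) (Fin p) ℝ) (Y : Ω → TensorGLM.Tensor K d)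
        (w₀ : TensorGLM.Params K p r),
        TensorGLM.BoundedDesign c₁ c₂ P X →
        (∀ ω k, Z ω k = Real.sqrt d • X ω k) →
        TensorGLM.TensorModel ν b φ w₀.coef P Z Y →
        P {ω | ¬ (TensorGLM.Feasible α (Z ω) w₀ → ∀ w : TensorGLM.Params K p r,
          TensorGLM.IsMLE b α (Z ω) (Y ω) w → TensorGLM.ErrorBounds d φ C w₀ w)}
          ≤ ENNReal.ofReal (Real.exp (-(p : ℝ)))) ∧
    (∀ ρ : ℝ, 0 < ρ → ρ < 1 → ∃ C : ℝ, 0 < C ∧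
      ∀ p d r : ℕ, 1 ≤ r → r ≤ p → (p : ℝ) ≤ ρ * d →
      ∀ (ν : Measure ℝ) (b : ℝ → ℝ) (φ : ℝ), TensorGLM.IsExpFamily ν b φ →
      ∀ α : ℝ≥0∞, 0 < α → TensorGLM.CurvatureBounds b α L U →
      ∀ (Ω : Type*) [MeasurableSpace Ω] (P : Measure Ω) [IsProbabilityMeasure P]
        (X : Ω → Fin K → Matrix (Fin d) (Fin p) ℝ) (Y : Ω → TensorGLM.Tensor K d)
        (w₀ : TensorGLM.Params K p r),
        TensorGLM.GaussianDesign P X →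
        TensorGLM.TensorModel ν b φ w₀.coef P X Y →
        P {ω | ¬ (TensorGLM.Feasible α (X ω) w₀ → ∀ w : TensorGLM.Params K p r,
          TensorGLM.IsMLE b α (X ω) (Y ω) w → TensorGLM.ErrorBounds d φ C w₀ w)}
          ≤ ENNReal.ofReal (Real.exp (-(p : ℝ)))) := by
  refine ⟨fun c₁ c₂ hc₁ hc₂ => ?_, fun ρ hρ0 hρ1 => ?_⟩
  · refine ⟨TensorGLM.rateConst K L U c₁ c₂, TensorGLM.rateConst_pos K hL hU hc₁ hc₂, ?_⟩
    intro p d r hr hrp hpd ν b φ hexp α _ hcurv Ω _ P _ X Z Y w₀ hX hZ hm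
    have hp : 1 ≤ p := hr.trans hrp
    refine (measure_mono_ae ?_).trans
      ((TensorGLM.measure_design_and_not_errorBounds_le hK hL hU hc₁ hc₂ hr hp (hp.trans hpd)
        hexp hcurv hm).trans (ENNReal.ofReal_le_ofReal (Real.exp_le_exp.2 ?_)))
    · filter_upwards [hX.designBounds hp hc₁.le hZ] with ω hω hbad
      exact ⟨hω, hbad⟩
    · have : (0 : ℝ) ≤ p := Nat.cast_nonneg p
      linarith
  · obtain ⟨c₁, c₂, hc₁, hc₂, hdes⟩ :=
      TensorGLM.GaussianDesign.exists_designBounds hK hρ0 hρ1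
    refine ⟨TensorGLM.rateConst K L U c₁ c₂, TensorGLM.rateConst_pos K hL hU hc₁ hc₂, ?_⟩
    intro p d r hr hrp hpd ν b φ hexp α _ hcurv Ω _ P _ X Y w₀ hX hm
    have hp : 1 ≤ p := hr.trans hrp
    have hp' : (1 : ℝ) ≤ p := by exact_mod_cast hp
    have hd : 1 ≤ d := by
      by_contra! h
      have h0 : d = 0 := by omega
      rw [h0, Nat.cast_zero, mul_zero] at hpd
      linarith
    -- The failure probability is split equally between the features and the conditional noise; the
    -- spare `e^(-p)` in the noise bound is at most `1/2`.
    have hhalf : Real.exp (-(2 * p : ℝ)) ≤ Real.exp (-(p : ℝ)) / 2 := by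
      have h2 : (2 : ℝ) ≤ Real.exp p := by
        have := Real.add_one_le_exp (p : ℝ)
        linarith
      rw [le_div_iff₀ two_pos]
      calc Real.exp (-(2 * p : ℝ)) * 2 ≤ Real.exp (-(2 * p : ℝ)) * Real.exp p := by gcongr
        _ = Real.exp (-(p : ℝ)) := by rw [← Real.exp_add]; congr 1; ring
    have hsub : {ω | ¬ (TensorGLM.Feasible α (X ω) w₀ → ∀ w : TensorGLM.Params K p r,
        TensorGLM.IsMLE b α (X ω) (Y ω) w →
          TensorGLM.ErrorBounds d φ (TensorGLM.rateConst K L U c₁ c₂) w₀ w)} ⊆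
        {ω | ¬ TensorGLM.DesignBounds (c₁ ^ 2 * d) (c₂ ^ 2 * d) (X ω)} ∪
        {ω | TensorGLM.DesignBounds (c₁ ^ 2 * d) (c₂ ^ 2 * d) (X ω) ∧
          ¬ (TensorGLM.Feasible α (X ω) w₀ → ∀ w : TensorGLM.Params K p r,
            TensorGLM.IsMLE b α (X ω) (Y ω) w →
              TensorGLM.ErrorBounds d φ (TensorGLM.rateConst K L U c₁ c₂) w₀ w)} := by
      intro ω hω
      by_cases h : TensorGLM.DesignBounds (c₁ ^ 2 * d) (c₂ ^ 2 * d) (X ω)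
      · exact Or.inr ⟨h, hω⟩
      · exact Or.inl h
    calc _ ≤ ENNReal.ofReal (Real.exp (-(p : ℝ)) / 2) + ENNReal.ofReal (Real.exp (-(p : ℝ)) / 2) :=
          (measure_mono hsub).trans ((measure_union_le _ _).trans (add_le_add
            (hdes p d hp hpd Ω P X hX)
            ((TensorGLM.measure_design_and_not_errorBounds_le hK hL hU hc₁ hc₂ hr hp hd hexp hcurv
              hm).trans (ENNReal.ofReal_le_ofReal hhalf))))
      _ = ENNReal.ofReal (Real.exp (-(p : ℝ))) := by
          rw [← ENNReal.ofReal_add (by positivity) (by positivity), add_halves]
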